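/- Let $E=\{0,1,2,\dots\}$, and let $Q=(q_{ij})_{i,j\ge 0}$ be a real matrix with $q_{ij}\ge 0$ for $i\ne j$, $q_i:=-q_{ii}\ge\sum_{j\neq i}q_{ij}$ for all $i$, $q_{0j}=0$ for all $j\ge 0$, and, for $i\ge 1$, $q_{i,i-1}>0$ and $q_{ij}=0$ for $0\le j<i-1$. Let $c_i=-\sum_{j\ge i-1}q_{ij}\ge 0$ $(i\ge 1)$ be the killing rates, and assume $c_{i_0}>0$ for some $i_0\ge 1$. Let $X=(X_t)_{t\ge0}$ be a single death process with killing corresponding to $Q$: under $\mathbb P_i$ $(i\in E)$, $X$ is a time-homogeneous Markov process on $E\cup\{\partial\}$ started at $i$, with right-continuous paths for the discrete topology, absorbed at the cemetery $\partial$, whose transition function $p_{ij}(t)=\mathbb P_i[X_t=j]$ $(i,j\in E)$ satisfies $p_{ij}'(0+)=q_{ij}$. Put $T_a=\inf\{t\ge0:X_t=a\}$, $T_{N+}=\inf\{t\ge0:X_t\in E,\ X_t\ge N\}$ and $T_\partial=\inf\{t\ge0:X_t=\partial\}$, with $\inf\emptyset=\infty$. For a function $f=(f_i)_{i\ge1}$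 with values in $[0,\infty)$ set $q_n^{(k)}(f)=\sum_{j\ge k}q_{nj}+f_n$, and $$G_n^{(n)}(f)=1\ (n\ge1),\qquad G_n^{(k)}(f)=\sum_{l=n+1}^{k}\frac{q_n^{(l)}(f)\,G_l^{(k)}(f)}{q_{n,n-1}}\ (k>n\ge1),\qquad W^{(f)}(i,j)=\sum_{k=i+1}^{j}\frac{G_k^{(j)}(f)}{q_{j,j-1}}\ (i,j\ge0),$$ where empty sums are $0$. Let $\omega=(\omega_i)_{i\ge1}$ be a non-negative function on $\{1,2,\dots\}$, and write $W=W^{(\omega+c)}$. Then: (1) for all integers $0\le a<i<N$, $$\mathbb E_i\Big[\exp\Big(-\int_0^{T_a}\omega(X_t)\,dt\Big);\,T_a<T_{N+}\wedge T_\partial\Big]=\frac{W(i,N)}{W(a,N)};$$ (2) for all integers $a\ge 0$ and $i,j,N$ with $a<i<N$ and $a<j<N$, $$\mathbb E_i\Big[\int_0^{T_a\wedge T_{N+}\wedge T_\partial}\exp\Big(-\int_0^t\omega(X_s)\,ds\Big)\mathbf 1_{\{X_t=j\}}\,dt\Big]=\frac{W(a,j)\,W(i,N)}{W(a,N)}-W(i,j);$$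 (3) for all integers $0\le a<i<N$, $$\mathbb E_i\Big[\exp\Big(-\int_0^{T_{N+}\wedge T_\partial}\omega(X_t)\,dt\Big);\,T_{N+}\wedge T_\partial<T_a\Big]=1+\sum_{i<j<N}\omega_jW(i,j)-\frac{W(i,N)}{W(a,N)}\Big(1+\sum_{a<j<N}\omega_jW(a,j)\Big).$$ -/

import Mathlib

open MeasureTheory Filter Topology
open scoped NNReal ENNReal

noncomputable section

namespace SingleDeath

/-- A totally stable transition rate matrix on `{0, 1, 2, …}` of single death type: off-diagonal
entries are non-negative, rows are summable with sum at most `0` (that is,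
`q_i = -q_{ii} ≥ ∑_{j ≠ i} q_{ij}`, with `q_i` finite), `0` is absorbing, and from `i ≥ 1` the only
downward jump is to `i - 1`, at a positive rate. -/
structure IsRateMatrix (Q : ℕ → ℕ → ℝ) : Prop where
  nonneg : ∀ i j, i ≠ j → 0 ≤ Q i j
  summable : ∀ i, Summable (Q i)
  row_sum_le : ∀ i, ∑' j, Q i j ≤ 0
  zero_row : ∀ j, Q 0 j = 0
  down_pos : ∀ i, 1 ≤ i → 0 < Q i (i - 1)
  skip_free : ∀ i j, j + 1 < i → Q i j = 0

/-- The killing rate `c_i = -∑_j q_{ij}`; for a single death matrix and `i ≥ 1` the terms with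
`j < i - 1` vanish. -/
def killingRate (Q : ℕ → ℕ → ℝ) (i : ℕ) : ℝ := -∑' j, Q i j

/-- `q_n^{(k)}(ω) = ∑_{j ≥ k} q_{nj} + ω_n`. -/
def qTail (Q : ℕ → ℕ → ℝ) (ω : ℕ → ℝ) (n k : ℕ) : ℝ := ∑' j, Q n (k + j) + ω n

/-- `G Q ω k n` is `G_n^{(k)}(ω)`, for `1 ≤ n ≤ k`: it is `1` for `n = k` and
`∑_{l = n+1}^{k} q_n^{(l)}(ω) G_l^{(k)}(ω) / q_{n,n-1}` for `n < k`. -/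
def G (Q : ℕ → ℕ → ℝ) (ω : ℕ → ℝ) (k n : ℕ) : ℝ :=
  if n = k then 1
  else ∑ l : Finset.Icc (n + 1) k, qTail Q ω n l * G Q ω k l / Q n (n - 1)
termination_by k - n
decreasing_by
  have := Finset.mem_Icc.mp l.2
  omega

/-- The scale-type function `W^{(ω)}(i,j) = ∑_{k = i+1}^{j} G_k^{(j)}(ω) / q_{j,j-1}`. -/
def W (Q : ℕ → ℕ → ℝ) (ω : ℕ → ℝ) (i j : ℕ) : ℝ :=
  ∑ k ∈ Finset.Icc (i + 1) j, G Q ω j k / Q j (j - 1)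

variable {Ω : Type*}

/-- The state space of the killed process is `E ∪ {∂}`, modelled by `Option ℕ` with `∂ = none`.
This is the transition function `p_{ij}(t) = ℙ_i[X_t = j]`, for `i, j ∈ E`. -/
def transProb [MeasurableSpace Ω] (X : ℝ≥0 → Ω → Option ℕ) (P : ℕ → Measure Ω)
    (t : ℝ≥0) (i j : ℕ) : ℝ :=
  (P i).real {w | X t w = some j}

/-- `X`, under the laws `P i` (`i ∈ E`), is a continuous-time Markov chain on `E ∪ {∂}` started
from `i`, with cemetery `∂` and with transition rate matrix `Q` on `E`: its paths are
right-continuous for the discrete topology, it is absorbed at `∂`, it is time-homogeneous Markov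
with transition function `p_{ij}(t)`, and `p_{ij}'(0+) = q_{ij}`. -/
structure IsKilledChain [MeasurableSpace Ω] (Q : ℕ → ℕ → ℝ) (X : ℝ≥0 → Ω → Option ℕ)
    (P : ℕ → Measure Ω) : Prop where
  prob : ∀ i, IsProbabilityMeasure (P i)
  measurable : ∀ t x, MeasurableSet {w | X t w = x}
  right_cont : ∀ w t, ∀ᶠ s in 𝓝[≥] t, X s w = X t w
  absorbed : ∀ w s t, s ≤ t → X s w = none → X t w = none
  markov : ∀ (n : ℕ) (t : ℕ → ℝ≥0) (x : ℕ → ℕ), Monotone t → t 0 = 0 →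
    (P (x 0)).real {w | ∀ k ≤ n, X (t k) w = some (x k)} =
      ∏ k ∈ Finset.range n, transProb X P (t (k + 1) - t k) (x k) (x (k + 1))
  rates : ∀ i j, Tendsto (fun t : ℝ≥0 => (transProb X P t i j - if i = j then 1 else 0) / (t : ℝ))
    (𝓝[>] 0) (𝓝 (Q i j))

/-- First entrance time `inf {t ≥ 0 : X_t ∈ S}`, with `inf ∅ = ∞`. -/
def entryTime (X : ℝ≥0 → Ω → Option ℕ) (S : Set (Option ℕ)) (w : Ω) : ℝ≥0∞ :=
  ⨅ (t : ℝ≥0) (_ : X t w ∈ S), (t : ℝ≥0∞)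

/-- `T_a = inf {t ≥ 0 : X_t = a}`. -/
def hitTime (X : ℝ≥0 → Ω → Option ℕ) (a : ℕ) : Ω → ℝ≥0∞ := entryTime X {some a}

/-- `T_{N+} = inf {t ≥ 0 : X_t ≥ N}`. -/
def passTime (X : ℝ≥0 → Ω → Option ℕ) (N : ℕ) : Ω → ℝ≥0∞ := entryTime X (some '' Set.Ici N)

/-- `T_∂ = inf {t ≥ 0 : X_t ∉ E}`. -/
def killTime (X : ℝ≥0 → Ω → Option ℕ) : Ω → ℝ≥0∞ := entryTime X {none}

/-- The Lebesgue integral `∫_0^T f(t) dt`, for `f ≥ 0` and `T ∈ [0, ∞]`. -/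
def timeIntegral (T : ℝ≥0∞) (f : ℝ≥0 → ℝ≥0∞) : ℝ≥0∞ :=
  ∫⁻ t in {t : ℝ | 0 ≤ t ∧ ENNReal.ofReal t < T}, f t.toNNReal

/-- The discount factor `exp (-∫_0^T ω(X_s) ds) ∈ [0, 1]`, for `T ∈ [0, ∞]`, where `ω ≥ 0` is
extended by `ω(∂) = 0` and `exp (-∞) = 0`. -/
def discount (ω : ℕ → ℝ) (X : ℝ≥0 → Ω → Option ℕ) (T : ℝ≥0∞) (w : Ω) : ℝ≥0∞ :=
  EReal.exp (-(timeIntegral T fun s => ENNReal.ofReal ((X s w).elim 0 ω) : EReal))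

end SingleDeath

end

open SingleDeath

/-! No strong Markov property and no martingale is used: each exit problem is reduced to linear
algebra on a finite set `S` of states.

Analytic side. Exchanging the order of summation in the definition of `W`, and using that row `k`
has only one entry below the diagonal, turns `(Q - g) W(·, j)` into the recursion defining `G`;
hence `(Q - g) W^{(g+c)}(·, j) = δ_j` on `{1, 2, …}` (`generator_W`). Since `W(l, N) = 0` for `l ≥
N`, the ratio `W(·, N) / W(a, N)` is harmonic on `(a, N)` with value `1` at `a` and `0` from `N` on,
and `green` solves the Poisson equation with source at `j`.

Probabilistic side. Sampling the path on a grid of mesh `t / (n + 1)` and letting `n → ∞` gives the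
Feynman–Kac formula `lintegral_discount_stay`: the discounted probability of staying in `S` up to
`t` and being at `j` is the `(i, j)` entry of `exp (t B)`, with `B` the restriction of `Q - diag g`
to `S`. Integrating in `t` and solving `B v = -e_j` identifies discounted occupation times
(`lintegral_occupation`); a function `u` with `B u ≤ -1` forces `exp (t B)` to decay.

Identity (2) is the case `S = (a, N)`. Skip-freeness ensures that leaving `(a, N)` is almost surely
the same as hitting `a`, passing `N` or being killed (`ae_exitTime_Ioo_eq`).

For (1), take `S = [a, N)` and put killing rate `n` at `a`. The discounted killing at `a` is `n`
times an occupation time, hence explicit; as `n → ∞` it concentrates at `T_a`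
(`tendsto_killing_at`), and the explicit value tends to `W(i, N) / W(a, N)`.

For (3), take expectations in the pathwise identity `∫_0^T f e^{-∫_0^t f} dt + e^{-∫_0^T f} = 1`,
where `f` is `ω` along the path and `T` the exit time of `(a, N)`: the integral is a combination of
Green functions, and the last term splits into (1) and (3). -/

noncomputable section

namespace SingleDeath

/-! ### Right-continuous step paths and their discretisation. -/

section

/-! ### Right-continuous paths in a discrete space -/

/-- A path that is right-continuous for the discrete topology. -/
def RightConst {α : Type*} (f : ℝ≥0 → α) : Prop := ∀ t, ∀ᶠ s in 𝓝[≥] t, f s = f t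

lemma RightConst.comp {α β : Type*} {f : ℝ≥0 → α} (hf : RightConst f) (g : α → β) :
    RightConst fun t => g (f t) := fun t => (hf t).mono fun _ hs => congrArg g hs

lemma le_ceil_div_mul (t : ℝ≥0) {h : ℝ≥0} (hh : 0 < h) : t ≤ (⌈t / h⌉₊ : ℝ≥0) * h := by
  calc t = t / h * h := (div_mul_cancel₀ t hh.ne').symm
    _ ≤ _ := by gcongr; exact Nat.le_ceil _

lemma ceil_div_mul_le (t : ℝ≥0) {h : ℝ≥0} (hh : 0 < h) : (⌈t / h⌉₊ : ℝ≥0) * h ≤ t + h := by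
  calc (⌈t / h⌉₊ : ℝ≥0) * h ≤ (t / h + 1) * h := by
        gcongr; exact (Nat.ceil_lt_add_one zero_le).le
    _ = t + h := by rw [add_mul, div_mul_cancel₀ t hh.ne', one_mul]

/-- Grid points approach `t` from the right, the side on which the paths are locally constant; a
path sampled there eventually takes exactly its value at `t`. -/
lemma tendsto_ceil_div_mul {h : ℕ → ℝ≥0} (hpos : ∀ n, 0 < h n) (h0 : Tendsto h atTop (𝓝 0))
    (t : ℝ≥0) : Tendsto (fun n => (⌈t / h n⌉₊ : ℝ≥0) * h n) atTop (𝓝[≥] t) := by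
  refine tendsto_nhdsWithin_iff.2 ⟨?_, Eventually.of_forall fun n => le_ceil_div_mul t (hpos n)⟩
  refine tendsto_of_tendsto_of_tendsto_of_le_of_le (tendsto_const_nhds (x := t))
    (h := fun n => t + h n) ?_ (fun n => le_ceil_div_mul t (hpos n))
    (fun n => ceil_div_mul_le t (hpos n))
  simpa using tendsto_const_nhds.add h0

lemma tendsto_div_succ (t : ℝ≥0) : Tendsto (fun n : ℕ => t / ((n : ℝ≥0) + 1)) atTop (𝓝 0) := by
  have := (NNReal.tendsto_coe.2
    (tendsto_const_nhds (x := t) (f := atTop (α := ℕ)))).mul tendsto_one_div_add_atTop_nhds_zero_nat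
  rw [← NNReal.tendsto_coe]
  simpa [div_eq_mul_inv] using this

/-- The function is the pointwise limit of its values at the next grid time, and each approximation
involves only countably many times. -/
lemma measurable_uncurry_of_rightConst {Ω : Type*} [MeasurableSpace Ω] {f : ℝ≥0 → Ω → ℝ≥0∞}
    (hf : ∀ t, Measurable (f t)) (hr : ∀ w, RightConst fun t => f t w) :
    Measurable (Function.uncurry f) := by
  set h : ℕ → ℝ≥0 := fun n => 1 / ((n : ℝ≥0) + 1)
  have hpos : ∀ n, 0 < h n := fun n => by positivity
  have h0 : Tendsto h atTop (𝓝 0) := tendsto_div_succ 1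
  refine measurable_of_tendsto_metrizable
    (f := fun n (p : ℝ≥0 × Ω) => f ((⌈p.1 / h n⌉₊ : ℝ≥0) * h n) p.2) (fun n => ?_) ?_
  · have h1 : Measurable fun q : ℕ × Ω => f ((q.1 : ℝ≥0) * h n) q.2 :=
      measurable_from_prod_countable_right fun k => hf ((k : ℝ≥0) * h n)
    exact h1.comp ((Nat.measurable_ceil.comp (measurable_fst.div_const (h n))).prodMk measurable_snd)
  · refine tendsto_pi_nhds.2 fun p => ?_
    refine tendsto_const_nhds.congr' ?_
    filter_upwards [(tendsto_ceil_div_mul hpos h0 p.1).eventually (hr p.2 p.1)] with n hn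
    exact hn.symm

lemma RightConst.measurable {f : ℝ≥0 → ℝ≥0∞} (hf : RightConst f) : Measurable f :=
  (measurable_uncurry_of_rightConst (Ω := Unit) (f := fun t _ => f t) (fun _ => measurable_const)
    fun _ => hf).comp (measurable_id.prodMk (measurable_const (a := ())))

lemma RightConst.measurable_real {f : ℝ≥0 → ℝ} (hf : RightConst f) : Measurable f := by
  have h1 : Measurable fun t => (ENNReal.ofReal (f t)).toReal - (ENNReal.ofReal (-f t)).toReal :=
    (hf.comp ENNReal.ofReal).measurable.ennreal_toReal.sub
      (hf.comp fun y => ENNReal.ofReal (-y)).measurable.ennreal_toReal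
  convert h1 using 2 with t
  rw [ENNReal.toReal_ofReal', ENNReal.toReal_ofReal', max_zero_sub_eq_self]

/-! ### Riemann sums -/

/-- The right-endpoint sum is the integral of the step function `s ↦ f (⌈s / h⌉ h)`, which converges
everywhere to `f`; dominated convergence applies. The last grid point is exactly `t`, so a bound on
`[0, t]` suffices. -/
lemma tendsto_riemannSum {f : ℝ≥0 → ℝ} (hf : RightConst f) {t : ℝ≥0} (ht : 0 < t) {C : ℝ}
    (hC : ∀ s ≤ t, |f s| ≤ C) :
    Tendsto (fun n : ℕ => ∑ k ∈ Finset.range (n + 1),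
      ((t / ((n : ℝ≥0) + 1) : ℝ≥0) : ℝ) * f (((k + 1 : ℕ) : ℝ≥0) * (t / ((n : ℝ≥0) + 1)))) atTop
      (𝓝 (∫ s in (0 : ℝ)..t, f s.toNNReal)) := by
  set h : ℕ → ℝ≥0 := fun n => t / ((n : ℝ≥0) + 1)
  have hpos : ∀ n, 0 < h n := fun n => by positivity
  have h0 : Tendsto h atTop (𝓝 0) := tendsto_div_succ t
  set F : ℕ → ℝ → ℝ := fun n s => f ((⌈s.toNNReal / h n⌉₊ : ℝ≥0) * h n)
  have hFm : ∀ n, Measurable (F n) := fun n =>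
    (measurable_from_top (f := fun k : ℕ => f ((k : ℝ≥0) * h n))).comp
      (Nat.measurable_ceil.comp (measurable_real_toNNReal.div_const (h n)))
  have hle : ∀ n (s : ℝ), s ≤ t → (⌈s.toNNReal / h n⌉₊ : ℝ≥0) * h n ≤ t := by
    intro n s hs
    have h1 : ⌈s.toNNReal / h n⌉₊ ≤ n + 1 := by
      rw [Nat.ceil_le, div_le_iff₀ (hpos n)]
      have : ((n + 1 : ℕ) : ℝ≥0) * h n = t := by simp only [h]; push_cast; field_simp
      rw [this]; exact Real.toNNReal_le_iff_le_coe.2 hs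
    calc (⌈s.toNNReal / h n⌉₊ : ℝ≥0) * h n ≤ ((n + 1 : ℕ) : ℝ≥0) * h n := by gcongr
      _ = t := by simp only [h]; push_cast; field_simp
  have hFC : ∀ n (s : ℝ), s ≤ t → ‖F n s‖ ≤ C := fun n s hs => hC _ (hle n s hs)
  have hint : ∀ n, (∫ s in (0 : ℝ)..t, F n s) = ∑ k ∈ Finset.range (n + 1),
      ((h n : ℝ≥0) : ℝ) * f (((k + 1 : ℕ) : ℝ≥0) * h n) := by
    intro n
    have hn : (((n + 1 : ℕ) : ℝ)) * (h n : ℝ) = t := by simp only [h]; push_cast; field_simp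
    have e := intervalIntegral.sum_integral_adjacent_intervals (μ := volume) (f := F n) (n := n + 1)
      (a := fun k => (k : ℝ) * (h n : ℝ)) (fun k hk => by
        have : ∀ j ≤ n + 1, (j : ℝ) * (h n : ℝ) ≤ t := fun j hj => by
          rw [← hn]; gcongr
        refine IntervalIntegrable.mono_fun (g := F n) (f := fun _ => C) (by simp)
          (hFm n).aestronglyMeasurable ?_
        refine (ae_restrict_iff' measurableSet_uIoc).2 (ae_of_all _ fun s hs => ?_)
        refine (hFC n s (hs.2.trans (max_le (this _ (by omega)) (this _ (by omega))))).trans ?_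
        exact le_abs_self C)
    simp only [Nat.cast_zero, zero_mul, hn] at e
    rw [← e]
    refine Finset.sum_congr rfl fun k _ => ?_
    have hk : (k : ℝ) * (h n : ℝ) ≤ ((k + 1 : ℕ) : ℝ) * (h n : ℝ) := by gcongr; omega
    rw [intervalIntegral.integral_congr_ae (g := fun _ => f (((k + 1 : ℕ) : ℝ≥0) * h n))]
    · rw [intervalIntegral.integral_const]; push_cast; simp; left; ring
    · refine ae_of_all _ fun s hs => ?_
      rw [Set.uIoc_of_le hk] at hs
      have hs0 : 0 ≤ s := le_trans (by positivity) hs.1.le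
      have : ⌈s.toNNReal / h n⌉₊ = k + 1 := by
        rw [Nat.ceil_eq_iff (by omega)]
        constructor
        · rw [lt_div_iff₀ (hpos n), Nat.add_sub_cancel, ← NNReal.coe_lt_coe]
          push_cast; rw [Real.coe_toNNReal _ hs0]; exact hs.1
        · rw [div_le_iff₀ (hpos n), ← NNReal.coe_le_coe]
          rw [Real.coe_toNNReal _ hs0]; exact_mod_cast hs.2
      simp only [F, this]
  simp only [h] at hint
  simp_rw [← hint]
  refine intervalIntegral.tendsto_integral_filter_of_dominated_convergence (fun _ => C)
    (Eventually.of_forall fun n => (hFm n).aestronglyMeasurable) (Eventually.of_forall fun n => ?_)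
    (by simp) ?_
  · refine ae_of_all _ fun s hs => hFC n s ?_
    rw [Set.uIoc_of_le t.coe_nonneg] at hs; exact hs.2
  · refine ae_of_all _ fun s _ => tendsto_const_nhds.congr' ?_
    filter_upwards [(tendsto_ceil_div_mul hpos h0 s.toNNReal).eventually (hf s.toNNReal)] with n hn
    exact hn.symm

/-! ### Entrance times -/

variable {Ω : Type*}

/-- Right-continuity is what makes the inequality strict: a path outside `F` at `t` keeps its value
on some `[t, u)`, so it cannot enter `F` before `u > t`. -/
lemma lt_entryTime_iff {X : ℝ≥0 → Ω → Option ℕ} {w : Ω} (hr : RightConst fun t => X t w)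
    (F : Set (Option ℕ)) (t : ℝ≥0) :
    (t : ℝ≥0∞) < entryTime X F w ↔ ∀ s ≤ t, X s w ∉ F := by
  constructor
  · intro h s hs hF
    have : entryTime X F w ≤ s := iInf₂_le s hF
    exact absurd (h.trans_le this) (by simpa using hs)
  · intro h
    obtain ⟨u, hu, hmem⟩ : ∃ u > t, ∀ s ∈ Set.Ico t u, X s w = X t w := by
      have := (hr t)
      rwa [eventually_iff, mem_nhdsGE_iff_exists_Ico_subset] at this
    have htu : (t : ℝ≥0∞) < u := by exact_mod_cast hu
    refine htu.trans_le (le_iInf₂ fun s hs => ?_)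
    have : u ≤ s := by
      by_contra! hsu
      rcases le_total s t with hst | hst
      · exact h s hst hs
      · exact h t le_rfl (hmem s ⟨hst, hsu⟩ ▸ hs)
    exact_mod_cast this

lemma entryTime_le_iff {X : ℝ≥0 → Ω → Option ℕ} {w : Ω} (hr : RightConst fun t => X t w)
    (F : Set (Option ℕ)) (t : ℝ≥0) :
    entryTime X F w ≤ t ↔ ∃ s ≤ t, X s w ∈ F := by
  rw [← not_lt, lt_entryTime_iff hr]; push Not; rfl

lemma entryTime_union (X : ℝ≥0 → Ω → Option ℕ) (F G : Set (Option ℕ)) (w : Ω) :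
    entryTime X (F ∪ G) w = min (entryTime X F w) (entryTime X G w) := by
  simp only [entryTime, Set.mem_union, iInf_or, iInf_inf_eq]

lemma apply_entryTime_mem {X : ℝ≥0 → Ω → Option ℕ} {w : Ω} (hr : RightConst fun t => X t w)
    {F : Set (Option ℕ)} {t : ℝ≥0} (h : entryTime X F w = t) : X t w ∈ F := by
  obtain ⟨s, hs, hF⟩ := (entryTime_le_iff hr F t).1 h.le
  have : (t : ℝ≥0∞) ≤ s := h ▸ iInf₂_le s hF
  rwa [le_antisymm (by exact_mod_cast this) hs]

end

/-! ### Exponential discounting along a path. -/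

section

/-! ### The exponential `x ↦ exp (-x)` on `[0, ∞]` and time integrals -/

/-- `exp (-x)` for `x ∈ [0, ∞]`. -/
def negExp (x : ℝ≥0∞) : ℝ≥0∞ := EReal.exp (-(x : EReal))

lemma negExp_top : negExp ⊤ = 0 := by simp [negExp]

lemma negExp_zero : negExp 0 = 1 := by simp [negExp]

lemma negExp_ofReal {r : ℝ} (hr : 0 ≤ r) :
    negExp (ENNReal.ofReal r) = ENNReal.ofReal (Real.exp (-r)) := by
  rw [negExp, EReal.coe_ennreal_ofReal, max_eq_left hr, ← EReal.coe_neg, EReal.exp_coe]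

lemma negExp_antitone : Antitone negExp := fun x y h =>
  EReal.exp_monotone (EReal.neg_le_neg_iff.2 (by exact_mod_cast h))

lemma continuous_negExp : Continuous negExp :=
  ENNReal.continuous_exp.comp (continuous_neg.comp continuous_coe_ennreal_ereal)

lemma measurable_negExp : Measurable negExp := continuous_negExp.measurable

lemma measurableSet_timeSet (T : ℝ≥0∞) : MeasurableSet {t : ℝ | 0 ≤ t ∧ ENNReal.ofReal t < T} :=
  measurableSet_Ici.inter (measurableSet_lt ENNReal.measurable_ofReal measurable_const)

lemma timeIntegral_congr {T : ℝ≥0∞} {f g : ℝ≥0 → ℝ≥0∞}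
    (h : ∀ t : ℝ≥0, (t : ℝ≥0∞) < T → f t = g t) : timeIntegral T f = timeIntegral T g :=
  setLIntegral_congr_fun (measurableSet_timeSet T) fun t ht => h t.toNNReal ht.2

lemma timeIntegral_mono {T : ℝ≥0∞} {f g : ℝ≥0 → ℝ≥0∞}
    (h : ∀ t : ℝ≥0, (t : ℝ≥0∞) < T → f t ≤ g t) : timeIntegral T f ≤ timeIntegral T g :=
  setLIntegral_mono' (measurableSet_timeSet T) fun t ht => h t.toNNReal ht.2

lemma timeIntegral_const_mul (T : ℝ≥0∞) {c : ℝ≥0∞} (hc : c ≠ ⊤) (f : ℝ≥0 → ℝ≥0∞) :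
    timeIntegral T (fun t => c * f t) = c * timeIntegral T f :=
  lintegral_const_mul' c _ hc

lemma timeIntegral_eq_lintegral_indicator (T : ℝ≥0∞) (f : ℝ≥0 → ℝ≥0∞) :
    timeIntegral T f =
      ∫⁻ t in Set.Ici (0 : ℝ), {t : ℝ≥0 | (t : ℝ≥0∞) < T}.indicator f t.toNNReal := by
  rw [timeIntegral, ← lintegral_indicator (measurableSet_timeSet T),
    ← lintegral_indicator measurableSet_Ici]
  refine lintegral_congr fun t => ?_
  by_cases h : 0 ≤ t <;> simp [Set.indicator, h, ENNReal.ofReal]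

lemma timeIntegral_top (f : ℝ≥0 → ℝ≥0∞) :
    timeIntegral ⊤ f = ∫⁻ t in Set.Ici (0 : ℝ), f t.toNNReal := by
  simp [timeIntegral, Set.Ici]

lemma timeIntegral_truncate (T : ℝ≥0∞) (f : ℝ≥0 → ℝ≥0∞) :
    timeIntegral T f = timeIntegral ⊤ ({t : ℝ≥0 | (t : ℝ≥0∞) < T}.indicator f) := by
  rw [timeIntegral_eq_lintegral_indicator, timeIntegral_top]

lemma timeSet_coe (t : ℝ≥0) :
    {s : ℝ | 0 ≤ s ∧ ENNReal.ofReal s < (t : ℝ≥0∞)} = Set.Ico 0 (t : ℝ) := by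
  ext s
  refine and_congr_right fun hs => ?_
  rw [← ENNReal.ofReal_coe_nnreal, ENNReal.ofReal_lt_ofReal_iff_of_nonneg hs]

lemma timeIntegral_coe (t : ℝ≥0) {f : ℝ≥0 → ℝ} (h0 : ∀ s, s ≤ t → 0 ≤ f s)
    (hi : IntervalIntegrable (fun s : ℝ => f s.toNNReal) volume 0 t) :
    timeIntegral t (fun s => ENNReal.ofReal (f s)) =
      ENNReal.ofReal (∫ s in (0 : ℝ)..t, f s.toNNReal) := by
  rw [timeIntegral, timeSet_coe, intervalIntegral.integral_of_le t.coe_nonneg,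
    ofReal_integral_eq_lintegral_ofReal
      ((intervalIntegrable_iff_integrableOn_Ioc_of_le t.coe_nonneg).1 hi),
    Measure.restrict_congr_set Ico_ae_eq_Ioc]
  exact (ae_restrict_iff' measurableSet_Ioc).2
    (ae_of_all _ fun s hs => h0 _ (Real.toNNReal_le_iff_le_coe.2 hs.2))

lemma RightConst.intervalIntegrable {f : ℝ≥0 → ℝ} (hf : RightConst f) {t : ℝ≥0} {C : ℝ}
    (hC : ∀ s ≤ t, |f s| ≤ C) :
    IntervalIntegrable (fun s : ℝ => f s.toNNReal) volume 0 t := by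
  refine IntervalIntegrable.mono_fun (f := fun _ => C) (by simp)
    (hf.measurable_real.comp measurable_real_toNNReal).aestronglyMeasurable ?_
  refine (ae_restrict_iff' measurableSet_uIoc).2 (ae_of_all _ fun s hs => ?_)
  rw [Set.uIoc_of_le t.coe_nonneg] at hs
  exact (hC _ (Real.toNNReal_le_iff_le_coe.2 hs.2)).trans (le_abs_self C)

lemma tendsto_timeIntegral_natCast (f : ℝ≥0 → ℝ≥0∞) :
    Tendsto (fun n : ℕ => timeIntegral n f) atTop (𝓝 (timeIntegral ⊤ f)) := by
  have hmono : Monotone fun n : ℕ => {t : ℝ | 0 ≤ t ∧ ENNReal.ofReal t < n} :=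
    fun m n h t ht => ⟨ht.1, ht.2.trans_le (by exact_mod_cast h)⟩
  have hU : (⋃ n : ℕ, {t : ℝ | 0 ≤ t ∧ ENNReal.ofReal t < n}) =
      {t : ℝ | 0 ≤ t ∧ ENNReal.ofReal t < ⊤} := by
    ext t
    simp only [Set.mem_iUnion, Set.mem_ofPred_eq, exists_and_left]
    refine and_congr_right fun _ => ⟨fun _ => ENNReal.ofReal_lt_top, fun _ => ?_⟩
    exact ENNReal.exists_nat_gt ENNReal.ofReal_ne_top
  have := setLIntegral_iUnion_of_directed (μ := volume) (fun t : ℝ => f t.toNNReal)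
    hmono.directed_le
  rw [hU] at this
  rw [timeIntegral, this]
  exact tendsto_atTop_iSup fun m n h => lintegral_mono_set (hmono h)

/-! ### The pathwise exponential identity -/

lemma hasDerivWithinAt_integral_of_rightConst {f : ℝ≥0 → ℝ} (hf : RightConst f) {C : ℝ}
    (hC : ∀ s, |f s| ≤ C) {x : ℝ} (hx : 0 ≤ x) :
    HasDerivWithinAt (fun u : ℝ => ∫ s in (0 : ℝ)..u, f s.toNNReal) (f x.toNNReal)
      (Set.Ioi x) x := by
  have hm := hf.measurable_real.comp measurable_real_toNNReal
  lift x to ℝ≥0 using hx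
  refine HasDerivWithinAt.mono (t := Set.Ici (x : ℝ)) ?_ Set.Ioi_subset_Ici_self
  refine intervalIntegral.integral_hasDerivWithinAt_right (hf.intervalIntegrable fun s _ => hC s)
    (t := Set.Ioi (x : ℝ)) hm.stronglyMeasurable.stronglyMeasurableAtFilter ?_
  refine tendsto_const_nhds.congr' ?_
  have h1 : Tendsto Real.toNNReal (𝓝[>] (x : ℝ)) (𝓝[≥] x) := by
    refine tendsto_nhdsWithin_iff.2 ⟨?_, ?_⟩
    · have := (continuous_real_toNNReal.tendsto (x : ℝ)).mono_left
        (nhdsWithin_le_nhds (s := Set.Ioi (x : ℝ)))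
      simpa using this
    · filter_upwards [self_mem_nhdsWithin] with y hy
      exact NNReal.le_toNNReal_of_coe_le (le_of_lt hy)
  filter_upwards [h1.eventually (hf x)] with y hy
  simp [hy]

lemma continuous_integral_of_rightConst {f : ℝ≥0 → ℝ} (hf : RightConst f) {C : ℝ}
    (hC : ∀ s, |f s| ≤ C) :
    Continuous fun u : ℝ => ∫ s in (0 : ℝ)..u, f s.toNNReal := by
  refine intervalIntegral.continuous_primitive (fun a b => ?_) 0
  refine IntervalIntegrable.mono_fun (f := fun _ => C) (by simp)
    (hf.measurable_real.comp measurable_real_toNNReal).aestronglyMeasurable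
    (ae_of_all _ fun s => (hC _).trans (le_abs_self C))

/-- With `F` the primitive of `f`, the integrand is the right derivative of `-exp (-F)`; the
fundamental theorem of calculus for continuous functions with a right derivative applies even though
`f` jumps. -/
lemma timeIntegral_mul_negExp_coe {f : ℝ≥0 → ℝ} (hf : RightConst f) {C : ℝ}
    (h0 : ∀ s, 0 ≤ f s) (hC : ∀ s, f s ≤ C) (t : ℝ≥0) :
    timeIntegral t (fun s => ENNReal.ofReal (f s) *
        negExp (timeIntegral s fun u => ENNReal.ofReal (f u))) +
      negExp (timeIntegral t fun u => ENNReal.ofReal (f u)) = 1 := by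
  have hC' : ∀ s, |f s| ≤ C := fun s => by rw [abs_of_nonneg (h0 s)]; exact hC s
  set F : ℝ → ℝ := fun u => ∫ s in (0 : ℝ)..u, f s.toNNReal with hF
  have hF0 : ∀ s : ℝ≥0, 0 ≤ F s := fun s =>
    intervalIntegral.integral_nonneg s.coe_nonneg fun _ _ => h0 _
  have hFc : Continuous F := continuous_integral_of_rightConst hf hC'
  have hneg : ∀ s : ℝ≥0, negExp (timeIntegral s fun u => ENNReal.ofReal (f u)) =
      ENNReal.ofReal (Real.exp (-F s)) := fun s => by
    rw [timeIntegral_coe s (fun u _ => h0 u) (hf.intervalIntegrable fun u _ => hC' u),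
      negExp_ofReal (hF0 s)]
  have hii : IntervalIntegrable (fun s : ℝ => f s.toNNReal * Real.exp (-F s)) volume 0 t :=
    (hf.intervalIntegrable (t := t) fun u _ => hC' u).mul_continuousOn
      (Real.continuous_exp.comp hFc.neg).continuousOn
  have hii' : IntervalIntegrable (fun s : ℝ => f s.toNNReal * Real.exp (-F s.toNNReal))
      volume 0 t := by
    refine hii.congr fun s hs => ?_
    rw [Set.uIoc_of_le t.coe_nonneg] at hs
    simp only [Real.coe_toNNReal _ hs.1.le]
  have key : (∫ s in (0 : ℝ)..t, f s.toNNReal * Real.exp (-F s)) = 1 - Real.exp (-F t) := by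
    have := intervalIntegral.integral_eq_sub_of_hasDeriv_right (a := 0) (b := (t : ℝ))
      (f := fun u => -Real.exp (-F u)) (f' := fun s => f s.toNNReal * Real.exp (-F s))
      (Real.continuous_exp.comp hFc.neg).neg.continuousOn (fun x hx => ?_) hii
    · rw [this]; simp [hF]; ring
    · rw [min_eq_left t.coe_nonneg] at hx
      have h1 := ((hasDerivWithinAt_integral_of_rightConst hf hC' hx.1.le).neg.exp).neg
      exact h1.congr_deriv (by simp only [Pi.neg_apply, hF]; ring)
  have hle : Real.exp (-F t) ≤ 1 := Real.exp_le_one_iff.2 (neg_nonpos.2 (hF0 t))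
  rw [hneg, timeIntegral_congr (g := fun s => ENNReal.ofReal (f s * Real.exp (-F s)))
      (fun s _ => by rw [hneg, ENNReal.ofReal_mul (h0 s)]),
    timeIntegral_coe t (fun s _ => mul_nonneg (h0 s) (Real.exp_nonneg _)) hii',
    intervalIntegral.integral_congr (g := fun s : ℝ => f s.toNNReal * Real.exp (-F s))
      (fun s hs => by
        rw [Set.uIcc_of_le t.coe_nonneg] at hs
        simp only [Real.coe_toNNReal _ hs.1]), key,
    ← ENNReal.ofReal_add (sub_nonneg.2 hle) (Real.exp_nonneg _)]
  simp

/-- `∫_0^T f(t) e^{-∫_0^t f} dt = 1 - e^{-∫_0^T f}` for a right-continuous step function `f` that is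
non-negative and bounded on `[0, T)`, where `T ∈ [0, ∞]`. -/
lemma timeIntegral_mul_negExp {f : ℝ≥0 → ℝ} (hf : RightConst f) {C : ℝ} {T : ℝ≥0∞}
    (h0 : ∀ s : ℝ≥0, (s : ℝ≥0∞) < T → 0 ≤ f s) (hC : ∀ s : ℝ≥0, (s : ℝ≥0∞) < T → f s ≤ C) :
    timeIntegral T (fun s => ENNReal.ofReal (f s) *
        negExp (timeIntegral s fun u => ENNReal.ofReal (f u))) +
      negExp (timeIntegral T fun u => ENNReal.ofReal (f u)) = 1 := by
  -- Cutting `f` off at `T` keeps it right-continuous, because `[0, T)` is open to the right of each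
  -- of its points, and makes it globally bounded. The horizon is then sent to infinity.
  set g : ℝ≥0 → ℝ := {t : ℝ≥0 | (t : ℝ≥0∞) < T}.indicator f with hg
  have hgf : ∀ s : ℝ≥0, (s : ℝ≥0∞) < T → g s = f s := fun s hs =>
    Set.indicator_of_mem (s := {t : ℝ≥0 | (t : ℝ≥0∞) < T}) hs f
  have hg0' : ∀ s : ℝ≥0, ¬ (s : ℝ≥0∞) < T → g s = 0 := fun s hs =>
    Set.indicator_of_notMem (s := {t : ℝ≥0 | (t : ℝ≥0∞) < T}) hs f
  have hgr : RightConst g := by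
    intro t
    by_cases ht : (t : ℝ≥0∞) < T
    · have h1 : ∀ᶠ s : ℝ≥0 in 𝓝[≥] t, (s : ℝ≥0∞) < T :=
        nhdsWithin_le_nhds ((ENNReal.continuous_coe.tendsto t).eventually (gt_mem_nhds ht))
      filter_upwards [h1, hf t] with s hs hs'
      rw [hgf s hs, hgf t ht, hs']
    · filter_upwards [self_mem_nhdsWithin] with s hs
      rw [hg0' t ht, hg0' s fun h => ht (lt_of_le_of_lt (by exact_mod_cast hs) h)]
  have hg0 : ∀ s, 0 ≤ g s := fun s => by
    by_cases hs : (s : ℝ≥0∞) < T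
    · rw [hgf s hs]; exact h0 s hs
    · rw [hg0' s hs]
  have hgC : ∀ s, g s ≤ max C 0 := fun s => by
    by_cases hs : (s : ℝ≥0∞) < T
    · rw [hgf s hs]; exact (hC s hs).trans (le_max_left _ _)
    · rw [hg0' s hs]; exact le_max_right _ _
  have hgfin := timeIntegral_mul_negExp_coe hgr hg0 hgC
  have hinf : timeIntegral ⊤ (fun s => ENNReal.ofReal (g s) *
        negExp (timeIntegral s fun u => ENNReal.ofReal (g u))) +
      negExp (timeIntegral ⊤ fun u => ENNReal.ofReal (g u)) = 1 := by
    refine tendsto_nhds_unique ((tendsto_timeIntegral_natCast _).add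
      ((continuous_negExp.tendsto _).comp (tendsto_timeIntegral_natCast _))) ?_
    refine tendsto_const_nhds.congr fun n => ?_
    exact_mod_cast (hgfin n).symm
  rw [← hinf, timeIntegral_truncate T, timeIntegral_truncate T]
  congr 1
  · refine timeIntegral_congr fun t _ => ?_
    by_cases ht : (t : ℝ≥0∞) < T
    · rw [Set.indicator_of_mem (by exact ht), hgf t ht]
      congr 2
      exact timeIntegral_congr fun s hs => by rw [hgf s (hs.trans ht)]
    · rw [Set.indicator_of_notMem (by exact ht), hg0' t ht]; simp
  · congr 1
    refine timeIntegral_congr fun t _ => ?_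
    by_cases ht : (t : ℝ≥0∞) < T
    · rw [Set.indicator_of_mem (by exact ht), hgf t ht]
    · rw [Set.indicator_of_notMem (by exact ht), hg0' t ht]; simp

end

/-! ### The Feynman–Kac formula on a finite set of states. -/

section

/-! ### Powers of perturbations of the identity in a Banach algebra -/

lemma norm_pow_succ_sub_pow_succ_le {𝔸 : Type*} [NormedRing 𝔸] {a b : 𝔸} {M : ℝ}
    (ha : ‖a‖ ≤ M) (hb : ‖b‖ ≤ M) (n : ℕ) :
    ‖a ^ (n + 1) - b ^ (n + 1)‖ ≤ (n + 1) * M ^ n * ‖a - b‖ := by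
  have hM : 0 ≤ M := (norm_nonneg a).trans ha
  induction n with
  | zero => simp
  | succ n ih =>
    have e : a ^ (n + 1 + 1) - b ^ (n + 1 + 1) =
        a ^ (n + 1) * (a - b) + (a ^ (n + 1) - b ^ (n + 1)) * b := by
      rw [pow_succ a (n + 1), pow_succ b (n + 1)]; noncomm_ring
    rw [e]
    calc _ ≤ ‖a ^ (n + 1)‖ * ‖a - b‖ + ‖a ^ (n + 1) - b ^ (n + 1)‖ * ‖b‖ :=
          (norm_add_le _ _).trans (add_le_add (norm_mul_le _ _) (norm_mul_le _ _))
      _ ≤ M ^ (n + 1) * ‖a - b‖ + (n + 1) * M ^ n * ‖a - b‖ * M := by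
          gcongr
          exact (norm_pow_le' a n.succ_pos).trans (by gcongr)
      _ = _ := by push_cast; ring

/-- The exponential form of the bound keeps `‖a n‖ ^ n` below a constant uniformly in `n`. -/
lemma exists_norm_le_exp_of_tendsto {𝔸 : Type*} [NormedRing 𝔸] [NormOneClass 𝔸]
    [NormedAlgebra ℝ 𝔸] {a : ℕ → 𝔸} {x : 𝔸}
    (h : Tendsto (fun n : ℕ => ((n : ℝ) + 1) • (a n - 1)) atTop (𝓝 x)) :
    ∃ C : ℝ, ∀ n : ℕ, ‖a n‖ ≤ Real.exp (C / (n + 1)) := by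
  obtain ⟨C, hC⟩ := h.norm.bddAbove_range
  refine ⟨C, fun n => ?_⟩
  have h1 : ‖((n : ℝ) + 1) • (a n - 1)‖ ≤ C := hC ⟨n, rfl⟩
  have hn : (0 : ℝ) < n + 1 := by positivity
  rw [norm_smul, Real.norm_of_nonneg hn.le] at h1
  have h2 : ‖a n - 1‖ ≤ C / (n + 1) := by rw [le_div_iff₀ hn]; linarith
  calc ‖a n‖ = ‖(a n - 1) + 1‖ := by simp
    _ ≤ ‖a n - 1‖ + ‖(1 : 𝔸)‖ := norm_add_le _ _
    _ ≤ C / (n + 1) + 1 := by rw [norm_one]; gcongr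
    _ ≤ _ := Real.add_one_le_exp _

/-- Compare `a n` with `b n = exp (x / (n + 1))`, whose `(n + 1)`-st power is exactly `exp x`. Both
are `1 + x / (n + 1)` up to `o(1 / n)`, and telescoping the difference of powers costs only a factor
of order `n`. -/
lemma tendsto_pow_exp {𝔸 : Type*} [NormedRing 𝔸] [NormOneClass 𝔸] [NormedAlgebra ℝ 𝔸]
    [CompleteSpace 𝔸] {a : ℕ → 𝔸} {x : 𝔸}
    (h : Tendsto (fun n : ℕ => ((n : ℝ) + 1) • (a n - 1)) atTop (𝓝 x)) :
    Tendsto (fun n : ℕ => a n ^ (n + 1)) atTop (𝓝 (NormedSpace.exp x)) := by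
  let _ : NormedAlgebra ℚ 𝔸 := NormedAlgebra.restrictScalars ℚ ℝ 𝔸
  set b : ℕ → 𝔸 := fun n => NormedSpace.exp ((1 / ((n : ℝ) + 1)) • x) with hb
  have hbp : ∀ n, b n ^ (n + 1) = NormedSpace.exp x := fun n => by
    rw [hb, ← NormedSpace.exp_nsmul, ← Nat.cast_smul_eq_nsmul ℝ, smul_smul]
    congr 1
    rw [Nat.cast_add_one, mul_one_div_cancel (by positivity), one_smul]
  have hbt : Tendsto (fun n : ℕ => ((n : ℝ) + 1) • (b n - 1)) atTop (𝓝 x) := by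
    have hd := (hasDerivAt_exp_smul_const (𝕂 := ℝ) x 0).tendsto_slope
    have hs : Tendsto (fun n : ℕ => 1 / ((n : ℝ) + 1)) atTop (𝓝[≠] 0) :=
      tendsto_nhdsWithin_iff.2 ⟨tendsto_one_div_add_atTop_nhds_zero_nat,
        Eventually.of_forall fun n => by simp; positivity⟩
    have := hd.comp hs
    simpa [slope, Function.comp_def, hb] using this
  obtain ⟨C₁, h₁⟩ := exists_norm_le_exp_of_tendsto h
  obtain ⟨C₂, h₂⟩ := exists_norm_le_exp_of_tendsto hbt
  have hdiff : Tendsto (fun n : ℕ => ‖((n : ℝ) + 1) • (a n - b n)‖) atTop (𝓝 0) := by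
    have := (h.sub hbt).norm
    simpa [← smul_sub] using this
  rw [tendsto_iff_norm_sub_tendsto_zero]
  refine squeeze_zero (fun _ => norm_nonneg _) (fun n => ?_)
    (by simpa using hdiff.const_mul (Real.exp (max (max C₁ C₂) 0)))
  set C := max (max C₁ C₂) 0
  have hn : (0 : ℝ) < n + 1 := by positivity
  have hM : ∀ D ≤ C, Real.exp (D / (n + 1)) ≤ Real.exp (C / (n + 1)) := fun D hD => by gcongr
  have key := norm_pow_succ_sub_pow_succ_le
    ((h₁ n).trans (hM _ ((le_max_left C₁ C₂).trans (le_max_left _ _))))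
    ((h₂ n).trans (hM _ ((le_max_right C₁ C₂).trans (le_max_left _ _)))) n
  rw [hbp n] at key
  refine key.trans ?_
  rw [norm_smul, Real.norm_of_nonneg hn.le, ← Real.exp_nat_mul]
  have : Real.exp (n * (C / (n + 1))) ≤ Real.exp C := by
    gcongr
    rw [mul_div_assoc', div_le_iff₀ hn]
    nlinarith [le_max_right (max C₁ C₂) (0 : ℝ)]
  calc _ = Real.exp (n * (C / (n + 1))) * ((n + 1) * ‖a n - b n‖) := by ring
    _ ≤ _ := by gcongr

/-! ### The skeleton chain -/

variable {Ω : Type*} [MeasurableSpace Ω] {Q : ℕ → ℕ → ℝ} {X : ℝ≥0 → Ω → Option ℕ}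
  {P : ℕ → Measure Ω}

lemma IsKilledChain.rightConst (hX : IsKilledChain Q X P) (w : Ω) : RightConst fun t => X t w :=
  hX.right_cont w

lemma IsKilledChain.measurable_comp (hX : IsKilledChain Q X P) (t : ℝ≥0) {β : Type*}
    [MeasurableSpace β] (u : Option ℕ → β) : Measurable fun w => u (X t w) := by
  let _ : MeasurableSpace (Option ℕ) := ⊤
  have : Measurable (X t) := measurable_to_countable' fun x => hX.measurable t x
  exact measurable_from_top.comp this

/-- The weight `φ` on `S`, extended by `0`. -/
def weight (S : Finset ℕ) (φ : ℕ → ℝ) (o : Option ℕ) : ℝ :=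
  o.elim 0 fun l => if l ∈ S then φ l else 0

lemma abs_weight_le_one {S : Finset ℕ} {φ : ℕ → ℝ} (h0 : ∀ l ∈ S, 0 ≤ φ l)
    (h1 : ∀ l ∈ S, φ l ≤ 1) (o : Option ℕ) : |weight S φ o| ≤ 1 := by
  rcases o with _ | l
  · simp [weight]
  · by_cases hl : l ∈ S
    · simpa [weight, hl, abs_of_nonneg (h0 l hl)] using h1 l hl
    · simp [weight, hl]

/-- The one-step matrix of the skeleton chain with step `h`, restricted to `S` and weighted by the
value of `φ` at the target. -/
def skeletonMatrix (X : ℝ≥0 → Ω → Option ℕ) (P : ℕ → Measure Ω) (S : Finset ℕ) (φ : ℕ → ℝ)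
    (h : ℝ≥0) : Matrix S S ℝ := fun k l => transProb X P h k l * φ l

/-- The first `m` steps are pinned to `x` so that an induction on `n` can run: the position at step
`m + 1` is summed over `S` and appended to `x`. When no free step remains, the Markov property in
the form of finite-dimensional distributions gives the product. -/
lemma integral_skeleton (hX : IsKilledChain Q X P) {S : Finset ℕ} {φ : ℕ → ℝ}
    (h0 : ∀ l ∈ S, 0 ≤ φ l) (h1 : ∀ l ∈ S, φ l ≤ 1) (h : ℝ≥0) (j : S) (n m : ℕ) (x : ℕ → ℕ)
    (hx : x m ∈ S) :
    ∫ w, {w | ∀ k ≤ m, X (k * h) w = some (x k)}.indicator 1 w *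
        (∏ k ∈ Finset.range n, weight S φ (X ((m + k + 1 : ℕ) * h) w)) *
        (if X ((m + n : ℕ) * h) w = some (j : ℕ) then 1 else 0) ∂(P (x 0)) =
      (∏ k ∈ Finset.range m, transProb X P h (x k) (x (k + 1))) *
        (skeletonMatrix X P S φ h ^ n) ⟨x m, hx⟩ j := by
  have := hX.prob
  have hmeas : ∀ (m : ℕ) (x : ℕ → ℕ), MeasurableSet {w | ∀ k ≤ m, X (k * h) w = some (x k)} := by
    intro m x
    have : {w | ∀ k ≤ m, X (k * h) w = some (x k)} = ⋂ k, ⋂ (_ : k ≤ m),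
        {w | X (k * h) w = some (x k)} := by ext w; simp
    rw [this]
    exact MeasurableSet.iInter fun k => MeasurableSet.iInter fun _ => hX.measurable _ _
  induction n generalizing m x with
  | zero =>
    have e : (fun w => {w | ∀ k ≤ m, X (k * h) w = some (x k)}.indicator (1 : Ω → ℝ) w *
        (∏ k ∈ Finset.range 0, weight S φ (X ((m + k + 1 : ℕ) * h) w)) *
        (if X ((m + 0 : ℕ) * h) w = some (j : ℕ) then 1 else 0)) =
        fun w => {w | ∀ k ≤ m, X (k * h) w = some (x k)}.indicator (1 : Ω → ℝ) w *
          (if x m = j then 1 else 0) := by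
      funext w
      by_cases hw : ∀ k ≤ m, X (k * h) w = some (x k)
      · simp [hw m le_rfl]
      · rw [Set.indicator_of_notMem (by exact hw)]; simp
    rw [e, integral_mul_const, integral_indicator_one (hmeas m x),
      hX.markov m (fun k => k * h) x (fun a b hab => by dsimp only; gcongr) (by simp)]
    congr 1
    · refine Finset.prod_congr rfl fun k _ => ?_
      congr 1
      push_cast
      rw [add_mul, one_mul, add_tsub_cancel_left]
    · rw [pow_zero, Matrix.one_apply]
      congr 1
      rw [Subtype.ext_iff]
  | succ n ih =>
    have hupd : ∀ l : S, ∀ k ≤ m, Function.update x (m + 1) (l : ℕ) k = x k := fun l k hk =>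
      Function.update_of_ne (by omega) _ _
    have e : ∀ w, {w | ∀ k ≤ m, X (k * h) w = some (x k)}.indicator (1 : Ω → ℝ) w *
        (∏ k ∈ Finset.range (n + 1), weight S φ (X ((m + k + 1 : ℕ) * h) w)) *
        (if X ((m + (n + 1) : ℕ) * h) w = some (j : ℕ) then 1 else 0) =
        ∑ l : S, φ l * ({w | ∀ k ≤ m + 1, X (k * h) w =
            some (Function.update x (m + 1) (l : ℕ) k)}.indicator (1 : Ω → ℝ) w *
          (∏ k ∈ Finset.range n, weight S φ (X ((m + 1 + k + 1 : ℕ) * h) w)) *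
          (if X ((m + 1 + n : ℕ) * h) w = some (j : ℕ) then 1 else 0)) := by
      intro w
      -- The weight at step `m + 1` vanishes off `S`, so it decomposes over the positions `l ∈ S`,
      -- each term pinning one more step.
      have hsplit : {w | ∀ k ≤ m, X (k * h) w = some (x k)}.indicator (1 : Ω → ℝ) w *
          weight S φ (X ((m + 1 : ℕ) * h) w) = ∑ l : S, φ l * {w | ∀ k ≤ m + 1, X (k * h) w =
            some (Function.update x (m + 1) (l : ℕ) k)}.indicator (1 : Ω → ℝ) w := by
        have hiff : ∀ l : S, (∀ k ≤ m + 1, X (k * h) w =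
            some (Function.update x (m + 1) (l : ℕ) k)) ↔
            (∀ k ≤ m, X (k * h) w = some (x k)) ∧ X ((m + 1 : ℕ) * h) w = some (l : ℕ) := by
          intro l
          constructor
          · refine fun H => ⟨fun k hk => ?_, ?_⟩
            · rw [H k (by omega), hupd l k hk]
            · rw [H (m + 1) le_rfl, Function.update_self]
          · rintro ⟨H1, H2⟩ k hk
            rcases Nat.lt_or_ge m k with hk' | hk'
            · obtain rfl : k = m + 1 := by omega
              rw [H2, Function.update_self]
            · rw [H1 k hk', hupd l k hk']
        by_cases hw : ∀ k ≤ m, X (k * h) w = some (x k)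
        · have hind : ∀ l : S, {w | ∀ k ≤ m + 1, X (k * h) w =
              some (Function.update x (m + 1) (l : ℕ) k)}.indicator (1 : Ω → ℝ) w =
              if X ((m + 1 : ℕ) * h) w = some (l : ℕ) then 1 else 0 := fun l => by
            split_ifs with hl
            · exact Set.indicator_of_mem (by exact (hiff l).2 ⟨hw, hl⟩) _
            · exact Set.indicator_of_notMem (by exact fun H => hl ((hiff l).1 H).2) _
          simp only [hind]
          rw [Set.indicator_of_mem (by exact hw), Pi.one_apply, one_mul]
          rcases hX1 : X ((m + 1 : ℕ) * h) w with _ | l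
          · simp [weight]
          · by_cases hl : l ∈ S
            · rw [Finset.sum_eq_single ⟨l, hl⟩]
              · simp [weight, hl]
              · rintro ⟨b, hb⟩ _ hne
                have : ¬ l = b := fun h => hne (Subtype.ext h.symm)
                simp [this]
              · simp
            · rw [Finset.sum_eq_zero]
              · simp [weight, hl]
              · rintro ⟨b, hb⟩ _
                have : ¬ l = b := fun h => hl (h ▸ hb)
                simp [this]
        · rw [Set.indicator_of_notMem (by exact hw), zero_mul, Finset.sum_eq_zero]
          intro l _
          rw [Set.indicator_of_notMem (by exact fun H => hw ((hiff l).1 H).1), mul_zero]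
      rw [Finset.prod_range_succ']
      simp only [← mul_assoc, ← Finset.sum_mul, ← hsplit]
      have e1 : ∀ k : ℕ, m + (k + 1) + 1 = m + 1 + k + 1 := fun k => by ring
      have e2 : m + (n + 1) = m + 1 + n := by ring
      simp only [e1, e2, add_zero]
      ring
    simp_rw [e]
    rw [integral_finsetSum]
    · rw [pow_succ', Matrix.mul_apply, Finset.mul_sum]
      refine Finset.sum_congr rfl fun l _ => ?_
      have ih' := ih (m + 1) (Function.update x (m + 1) (l : ℕ))
        (by rw [Function.update_self]; exact l.2)
      rw [hupd l 0 (Nat.zero_le _)] at ih'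
      have e3 : ∏ k ∈ Finset.range m, transProb X P h (Function.update x (m + 1) (l : ℕ) k)
          (Function.update x (m + 1) (l : ℕ) (k + 1)) =
          ∏ k ∈ Finset.range m, transProb X P h (x k) (x (k + 1)) :=
        Finset.prod_congr rfl fun k hk => by
          have := Finset.mem_range.1 hk
          rw [hupd l k (by omega), hupd l (k + 1) (by omega)]
      have e4 : (⟨Function.update x (m + 1) (l : ℕ) (m + 1), by
          rw [Function.update_self]; exact l.2⟩ : S) = l := Subtype.ext (Function.update_self ..)
      have e5 : skeletonMatrix X P S φ h ⟨x m, hx⟩ l = transProb X P h (x m) l * φ l := rfl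
      rw [integral_const_mul, ih', Finset.prod_range_succ, e3, e4, hupd l m le_rfl,
        Function.update_self, e5]
      ring
    · intro l _
      refine Integrable.of_bound (C := 1) ?_ (ae_of_all _ fun w => ?_) |>.const_mul _
      · refine Measurable.aestronglyMeasurable ?_
        refine ((measurable_one.indicator (hmeas _ _)).mul
          (Finset.measurable_prod _ fun k _ => hX.measurable_comp _ _)).mul ?_
        exact hX.measurable_comp _ fun o => if o = some (j : ℕ) then (1 : ℝ) else 0
      · rw [norm_mul, norm_mul, norm_prod]
        refine mul_le_one₀ (mul_le_one₀ ?_ (by positivity) ?_) (by positivity) ?_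
        · rw [Set.indicator_apply]; split_ifs <;> simp
        · exact Finset.prod_le_one (fun _ _ => norm_nonneg _)
            fun k _ => abs_weight_le_one h0 h1 _
        · split_ifs <;> simp

/-! ### Convergence of the skeleton functionals -/

/-- On a path that stays in `S` the product is the exponential of minus a Riemann sum. On a path
that leaves `S`, right-continuity places a grid point at a moment outside `S` once the mesh is
small, and one factor is `0`. -/
lemma tendsto_prod_weight {x : ℝ≥0 → Option ℕ} (hx : RightConst x) (S : Finset ℕ) (g : ℕ → ℝ)
    {t : ℝ≥0} (ht : 0 < t) :
    Tendsto (fun n : ℕ => ∏ k ∈ Finset.range (n + 1),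
      weight S (fun l => Real.exp (-((t / ((n : ℝ≥0) + 1) : ℝ≥0) : ℝ) * g l))
        (x ((k + 1 : ℕ) * (t / ((n : ℝ≥0) + 1))))) atTop
      (𝓝 ({x : ℝ≥0 → Option ℕ | ∀ s ≤ t, x s ∈ some '' (S : Set ℕ)}.indicator
        (fun x => Real.exp (-∫ s in (0 : ℝ)..t, (x s.toNNReal).elim 0 g)) x)) := by
  set h : ℕ → ℝ≥0 := fun n => t / ((n : ℝ≥0) + 1)
  have hpos : ∀ n, 0 < h n := fun n => by positivity
  have hh0 : Tendsto h atTop (𝓝 0) := tendsto_div_succ t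
  have hn1 : ∀ n : ℕ, ((n + 1 : ℕ) : ℝ≥0) * h n = t := fun n => by
    simp only [h]; push_cast; field_simp
  by_cases hstay : ∀ s ≤ t, x s ∈ some '' (S : Set ℕ)
  · rw [Set.indicator_of_mem (by exact hstay)]
    have hfr : RightConst fun s => (x s).elim 0 g := hx.comp fun o => o.elim 0 g
    have hb : ∀ s ≤ t, |(x s).elim 0 g| ≤ ∑ l ∈ S, |g l| := by
      intro s hs
      obtain ⟨l, hl, hxl⟩ := hstay s hs
      rw [← hxl]
      exact Finset.single_le_sum (f := fun l => |g l|) (fun _ _ => abs_nonneg _) hl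
    have := (Real.continuous_exp.tendsto _).comp (tendsto_riemannSum hfr ht hb).neg
    refine this.congr fun n => ?_
    simp only [Function.comp_def]
    rw [← Finset.sum_neg_distrib, Real.exp_sum]
    refine Finset.prod_congr rfl fun k hk => ?_
    have hk' : ((k + 1 : ℕ) : ℝ≥0) * h n ≤ t := by
      rw [← hn1 n]
      have := Finset.mem_range.1 hk
      gcongr; omega
    obtain ⟨l, hl, hxl⟩ := hstay _ hk'
    simp only [h] at hxl
    have hl' : l ∈ S := hl
    rw [← hxl]
    simp [weight, hl']
  · rw [Set.indicator_of_notMem (by exact hstay)]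
    push Not at hstay
    -- Time `0` is not among the sampled times; a path outside `S` at time `0` is still outside
    -- shortly afterwards.
    obtain ⟨s, hs0, hst, hs⟩ : ∃ s, 0 < s ∧ s ≤ t ∧ x s ∉ some '' (S : Set ℕ) := by
      obtain ⟨s, hst, hs⟩ := hstay
      rcases eq_or_ne s 0 with rfl | hne
      · have h2 : Tendsto h atTop (𝓝[≥] 0) :=
          tendsto_nhdsWithin_iff.2 ⟨hh0, Eventually.of_forall fun n => (hpos n).le⟩
        obtain ⟨n, hn⟩ := (h2.eventually (hx 0)).exists
        refine ⟨h n, hpos n, ?_, hn ▸ hs⟩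
        exact div_le_self t.2 (by simp)
      · exact ⟨s, pos_iff_ne_zero.2 hne, hst, hs⟩
    refine tendsto_const_nhds.congr' ?_
    filter_upwards [(tendsto_ceil_div_mul hpos hh0 s).eventually (hx s)] with n hn
    have hc1 : 0 < ⌈s / h n⌉₊ := Nat.ceil_pos.2 (div_pos hs0 (hpos n))
    have hc2 : ⌈s / h n⌉₊ ≤ n + 1 := by
      rw [Nat.ceil_le, div_le_iff₀ (hpos n), hn1]; exact hst
    symm
    refine Finset.prod_eq_zero (i := ⌈s / h n⌉₊ - 1) (Finset.mem_range.2 (by omega)) ?_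
    rw [Nat.sub_add_cancel hc1]
    change weight _ _ (x (⌈s / h n⌉₊ * h n)) = 0
    rw [hn]
    rcases hxs : x s with _ | l
    · rfl
    · have : l ∉ S := fun hl => hs ⟨l, hl, hxs.symm⟩
      simp [weight, this]

/-- The generator `Q - diag g`, restricted to `S`. -/
def genMatrix (Q : ℕ → ℕ → ℝ) (g : ℕ → ℝ) (S : Finset ℕ) : Matrix S S ℝ :=
  fun k l => Q k l - if k = l then g k else 0

attribute [local instance] Matrix.linftyOpNormedRing Matrix.linftyOpNormedAlgebra

/-- Entrywise this is a product rule at `h = 0`: `(p e^{-hg} - δ) / h = ((p - δ) / h) e^{-hg} + δ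
(e^{-hg} - 1) / h`. -/
lemma tendsto_skeletonMatrix (hX : IsKilledChain Q X P) (S : Finset ℕ) (g : ℕ → ℝ)
    {t : ℝ≥0} (ht : 0 < t) :
    Tendsto (fun n : ℕ => ((n : ℝ) + 1) • (skeletonMatrix X P S
      (fun l => Real.exp (-((t / ((n : ℝ≥0) + 1) : ℝ≥0) : ℝ) * g l)) (t / ((n : ℝ≥0) + 1)) - 1))
      atTop (𝓝 ((t : ℝ) • genMatrix Q g S)) := by
  set h : ℕ → ℝ≥0 := fun n => t / ((n : ℝ≥0) + 1)
  have hpos : ∀ n, 0 < h n := fun n => by positivity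
  have hh : Tendsto h atTop (𝓝[>] 0) :=
    tendsto_nhdsWithin_iff.2 ⟨tendsto_div_succ t, Eventually.of_forall hpos⟩
  have hhr : Tendsto (fun n => (h n : ℝ)) atTop (𝓝[≠] 0) :=
    tendsto_nhdsWithin_iff.2 ⟨NNReal.tendsto_coe.2 (tendsto_div_succ t),
      Eventually.of_forall fun n => by simpa using (hpos n).ne'⟩
  refine tendsto_pi_nhds.2 fun k => tendsto_pi_nhds.2 fun l => ?_
  have h1 := (hX.rates k l).comp hh
  have h2 : Tendsto (fun n => Real.exp (-(h n : ℝ) * g l)) atTop (𝓝 1) := by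
    have : Tendsto (fun n => -(h n : ℝ) * g l) atTop (𝓝 (-(0 : ℝ) * g l)) :=
      ((tendsto_nhdsWithin_iff.1 hhr).1.neg).mul_const _
    simpa [Function.comp_def] using (Real.continuous_exp.tendsto _).comp this
  have h3 : Tendsto (fun n => (Real.exp (-(h n : ℝ) * g l) - 1) / h n) atTop (𝓝 (-g l)) := by
    have hd : HasDerivAt (fun y : ℝ => Real.exp (-y * g l)) (-g l) 0 := by
      have := ((hasDerivAt_id (0 : ℝ)).neg.mul_const (g l)).exp
      simpa using this
    have := hd.tendsto_slope.comp hhr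
    refine this.congr fun n => ?_
    simp [slope, div_eq_inv_mul]
  have h4 := ((h1.mul h2).add (h3.const_mul (if (k : ℕ) = l then (1 : ℝ) else 0))).const_mul (t : ℝ)
  have hlim : (t : ℝ) • genMatrix Q g S k l =
      t * (Q k l * 1 + (if (k : ℕ) = l then (1 : ℝ) else 0) * -g l) := by
    by_cases hkl : k = l
    · subst hkl; simp only [genMatrix, ↓reduceIte, smul_eq_mul]; ring
    · have : (k : ℕ) ≠ l := fun h => hkl (Subtype.ext h)
      simp [genMatrix, hkl, this]
  change Tendsto _ _ (𝓝 ((t : ℝ) • genMatrix Q g S k l))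
  rw [hlim]
  refine h4.congr fun n => ?_
  have hn : (n : ℝ) + 1 = t / h n := by
    simp only [h]; push_cast; field_simp
  change _ = ((n : ℝ) + 1) • (skeletonMatrix X P S
    (fun l => Real.exp (-(h n : ℝ) * g l)) (h n) k l - (1 : Matrix S S ℝ) k l)
  have hne : (h n : ℝ) ≠ 0 := by simpa using (hpos n).ne'
  have h1' : (1 : Matrix S S ℝ) k l = if (k : ℕ) = l then (1 : ℝ) else 0 := by
    rw [Matrix.one_apply]; congr 1; rw [Subtype.ext_iff]
  rw [hn, h1', smul_eq_mul, skeletonMatrix, Function.comp]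
  field_simp
  ring

/-- The Feynman–Kac formula for the chain killed on leaving the finite set `S`. -/
lemma lintegral_discount_stay (hX : IsKilledChain Q X P) {S : Finset ℕ} {g : ℕ → ℝ}
    (hg : ∀ l ∈ S, 0 ≤ g l) {t : ℝ≥0} (ht : 0 < t) (i j : S) :
    ∫⁻ w, {w | (∀ s ≤ t, X s w ∈ some '' (S : Set ℕ)) ∧ X t w = some (j : ℕ)}.indicator
        (fun w => discount g X t w) w ∂(P i) =
      ENNReal.ofReal (NormedSpace.exp ((t : ℝ) • genMatrix Q g S) i j) ∧
    0 ≤ NormedSpace.exp ((t : ℝ) • genMatrix Q g S) i j := by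
  have := hX.prob
  have : Nonempty S := ⟨i⟩
  set h : ℕ → ℝ≥0 := fun n => t / ((n : ℝ≥0) + 1) with hh
  have hn1 : ∀ n : ℕ, ((n + 1 : ℕ) : ℝ≥0) * h n = t := fun n => by
    simp only [h]; push_cast; field_simp
  set φ : ℕ → ℕ → ℝ := fun n l => Real.exp (-((h n : ℝ≥0) : ℝ) * g l)
  have hφ0 : ∀ n, ∀ l ∈ S, 0 ≤ φ n l := fun n l _ => Real.exp_nonneg _
  have hφ1 : ∀ n, ∀ l ∈ S, φ n l ≤ 1 := fun n l hl => Real.exp_le_one_iff.2 (by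
    have := mul_nonneg (h n).coe_nonneg (hg l hl); linarith)
  set F : ℕ → Ω → ℝ := fun n w => {w | X 0 w = some (i : ℕ)}.indicator 1 w *
    (∏ k ∈ Finset.range (n + 1), weight S (φ n) (X ((k + 1 : ℕ) * h n) w)) *
    (if X t w = some (j : ℕ) then 1 else 0)
  set K : Ω → ℝ := fun w => {w | X 0 w = some (i : ℕ)}.indicator 1 w *
    ({x : ℝ≥0 → Option ℕ | ∀ s ≤ t, x s ∈ some '' (S : Set ℕ)}.indicator
        (fun x => Real.exp (-∫ s in (0 : ℝ)..t, (x s.toNNReal).elim 0 g)) fun s => X s w) *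
    (if X t w = some (j : ℕ) then 1 else 0)
  have hFm : ∀ n, Measurable (F n) := fun n =>
    ((measurable_one.indicator (hX.measurable _ _)).mul
      (Finset.measurable_prod _ fun k _ => hX.measurable_comp _ _)).mul
        (hX.measurable_comp _ fun o => if o = some (j : ℕ) then (1 : ℝ) else 0)
  have hFb : ∀ n w, ‖F n w‖ ≤ 1 := fun n w => by
    simp only [F]
    rw [norm_mul, norm_mul, norm_prod]
    refine mul_le_one₀ (mul_le_one₀ ?_ (by positivity) ?_) (by positivity) ?_
    · rw [Set.indicator_apply]; split_ifs <;> simp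
    · exact Finset.prod_le_one (fun _ _ => norm_nonneg _)
        fun k _ => abs_weight_le_one (hφ0 n) (hφ1 n) _
    · split_ifs <;> simp
  have hFK : ∀ w, Tendsto (fun n => F n w) atTop (𝓝 (K w)) := fun w =>
    ((tendsto_prod_weight (hX.rightConst w) S g ht).const_mul _).mul_const _
  have hint : ∀ n, ∫ w, F n w ∂(P i) =
      (skeletonMatrix X P S (φ n) (h n) ^ (n + 1)) i j := fun n => by
    have := integral_skeleton hX (hφ0 n) (hφ1 n) (h n) j (n + 1) 0 (fun _ => (i : ℕ)) i.2
    simpa only [zero_add, hn1, Finset.range_zero, Finset.prod_empty, one_mul, Subtype.coe_eta,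
      Nat.le_zero, forall_eq, Nat.cast_zero, zero_mul] using this
  have hKint : ∫ w, K w ∂(P i) = NormedSpace.exp ((t : ℝ) • genMatrix Q g S) i j := by
    have l1 := tendsto_integral_of_dominated_convergence (μ := P i) (F := F) (f := K) (fun _ => 1)
      (fun n => (hFm n).aestronglyMeasurable) (integrable_const _)
      (fun n => ae_of_all _ (hFb n)) (ae_of_all _ hFK)
    have l2 := tendsto_pow_exp (tendsto_skeletonMatrix hX S g ht)
    have l3 := (tendsto_pi_nhds.1 (tendsto_pi_nhds.1 l2 i)) j
    refine tendsto_nhds_unique l1 (l3.congr fun n => ?_)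
    exact (hint n).symm
  have hKm : Measurable K := measurable_of_tendsto_metrizable hFm (tendsto_pi_nhds.2 hFK)
  have hK0 : ∀ w, 0 ≤ K w := fun w => by
    refine mul_nonneg (mul_nonneg ?_ ?_) ?_
    · exact Set.indicator_nonneg (fun _ _ => zero_le_one) _
    · exact Set.indicator_nonneg (fun _ _ => Real.exp_nonneg _) _
    · split_ifs <;> simp
  have hKi : Integrable K (P i) := Integrable.of_bound (C := 1) hKm.aestronglyMeasurable
    (ae_of_all _ fun w => le_of_tendsto (hFK w).norm (Eventually.of_forall fun n => hFb n w))
  -- The Markov property with no step says that the chain starts at `i` almost surely.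
  have hstart : ∀ᵐ w ∂(P i), X 0 w = some (i : ℕ) := by
    have := hX.markov 0 (fun _ => 0) (fun _ => (i : ℕ)) monotone_const rfl
    simp only [Nat.le_zero, forall_eq, Finset.range_zero, Finset.prod_empty] at this
    rw [ae_iff]
    have h2 := (prob_compl_eq_zero_iff (μ := P i) (hX.measurable 0 (some (i : ℕ)))).2 (by
      rw [← ENNReal.toReal_eq_one_iff]; exact this)
    exact h2
  refine ⟨?_, hKint ▸ integral_nonneg hK0⟩
  rw [← hKint, ofReal_integral_eq_lintegral_ofReal hKi (ae_of_all _ hK0)]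
  refine lintegral_congr_ae ?_
  filter_upwards [hstart] with w hw
  by_cases hs : ∀ s ≤ t, X s w ∈ some '' (S : Set ℕ)
  · by_cases hj : X t w = some (j : ℕ)
    · rw [Set.indicator_of_mem (by exact ⟨hs, hj⟩)]
      simp only [K]
      rw [Set.indicator_of_mem (by exact hw), Set.indicator_of_mem (by exact hs), if_pos hj]
      simp only [Pi.one_apply, one_mul, mul_one]
      have hfr : RightConst fun s => (X s w).elim 0 g := (hX.rightConst w).comp fun o => o.elim 0 g
      have h0 : ∀ s ≤ t, 0 ≤ (X s w).elim 0 g := by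
        intro s hst
        obtain ⟨l, hl, hxl⟩ := hs s hst
        rw [← hxl]; exact hg l hl
      have hb : ∀ s ≤ t, |(X s w).elim 0 g| ≤ ∑ l ∈ S, |g l| := by
        intro s hst
        obtain ⟨l, hl, hxl⟩ := hs s hst
        rw [← hxl]
        exact Finset.single_le_sum (f := fun l => |g l|) (fun _ _ => abs_nonneg _) hl
      change negExp _ = _
      rw [timeIntegral_coe t h0 (hfr.intervalIntegrable hb), negExp_ofReal]
      exact intervalIntegral.integral_nonneg t.coe_nonneg fun u hu =>
        h0 _ (Real.toNNReal_le_iff_le_coe.2 hu.2)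
    · rw [Set.indicator_of_notMem fun H => hj H.2]; simp [K, hj]
  · rw [Set.indicator_of_notMem fun H => hs H.1]
    simp only [K]
    rw [Set.indicator_of_notMem (s := {x : ℝ≥0 → Option ℕ | _}) (by exact hs)]; simp

end

/-! ### Harmonic functions of the generator, and integrated matrix semigroups. -/

section

/-! ### The scale function -/

section Scale

variable {Q : ℕ → ℕ → ℝ}

lemma G_self (Q : ℕ → ℕ → ℝ) (f : ℕ → ℝ) (k : ℕ) : G Q f k k = 1 := by
  rw [G, if_pos rfl]

lemma G_of_ne (Q : ℕ → ℕ → ℝ) (f : ℕ → ℝ) {k n : ℕ} (h : n ≠ k) :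
    G Q f k n = ∑ l ∈ Finset.Icc (n + 1) k, qTail Q f n l * G Q f k l / Q n (n - 1) := by
  rw [G, if_neg h]
  exact Finset.sum_coe_sort (Finset.Icc (n + 1) k)
    fun l => qTail Q f n l * G Q f k l / Q n (n - 1)

lemma qTail_nonneg (hQ : IsRateMatrix Q) {f : ℕ → ℝ} {n l : ℕ} (hf : 0 ≤ f n) (hnl : n < l) :
    0 ≤ qTail Q f n l :=
  add_nonneg (tsum_nonneg fun j => hQ.nonneg _ _ (by omega)) hf

lemma G_nonneg (hQ : IsRateMatrix Q) {f : ℕ → ℝ} (hf : ∀ n, 1 ≤ n → 0 ≤ f n) (k : ℕ) :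
    ∀ d n, k - n ≤ d → 1 ≤ n → 0 ≤ G Q f k n := by
  intro d
  induction d with
  | zero =>
    intro n hd hn
    rcases eq_or_ne n k with rfl | hne
    · rw [G_self]; exact zero_le_one
    · rw [G_of_ne Q f hne, Finset.Icc_eq_empty (by omega)]; simp
  | succ d ih =>
    intro n hd hn
    rcases eq_or_ne n k with rfl | hne
    · rw [G_self]; exact zero_le_one
    · rw [G_of_ne Q f hne]
      refine Finset.sum_nonneg fun l hl => ?_
      have := Finset.mem_Icc.1 hl
      exact div_nonneg (mul_nonneg (qTail_nonneg hQ (hf n hn) (by omega))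
        (ih l (by omega) (by omega))) (hQ.down_pos n hn).le

lemma W_eq_zero (Q : ℕ → ℕ → ℝ) (f : ℕ → ℝ) {i j : ℕ} (h : j ≤ i) : W Q f i j = 0 := by
  rw [W, Finset.Icc_eq_empty (by omega), Finset.sum_empty]

lemma W_pos (hQ : IsRateMatrix Q) {f : ℕ → ℝ} (hf : ∀ n, 1 ≤ n → 0 ≤ f n) {i j : ℕ}
    (h : i < j) : 0 < W Q f i j := by
  have hq := hQ.down_pos j (by omega)
  refine Finset.sum_pos' (fun k hk => ?_) ⟨j, Finset.mem_Icc.2 ⟨h, le_rfl⟩, ?_⟩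
  · exact div_nonneg (G_nonneg hQ hf j _ k le_rfl (by have := Finset.mem_Icc.1 hk; omega)) hq.le
  · rw [G_self]; positivity

lemma killingRate_nonneg (hQ : IsRateMatrix Q) (i : ℕ) : 0 ≤ killingRate Q i :=
  neg_nonneg.2 (hQ.row_sum_le i)

/-- The full row sums to `-c_k`; adding `c` to the discount function therefore absorbs the killing
into the tail `q_k^{(m)}`. -/
lemma sum_range_row (hQ : IsRateMatrix Q) (g : ℕ → ℝ) (k m : ℕ) :
    ∑ l ∈ Finset.range m, Q k l = g k - qTail Q (g + killingRate Q) k m := by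
  have h := (hQ.summable k).sum_add_tsum_nat_add m
  have e : ∑' j, Q k (m + j) = ∑' j, Q k (j + m) := tsum_congr fun j => by rw [add_comm]
  simp only [qTail, killingRate, Pi.add_apply, e]
  linarith

/-- A summation by parts: `W(l, j)` is itself a sum over `m > l`, so exchanging the sums produces
partial row sums against `G`. -/
lemma sum_range_mul_W (Q : ℕ → ℕ → ℝ) (f r : ℕ → ℝ) (j : ℕ) :
    ∑ l ∈ Finset.range j, r l * W Q f l j =
      ∑ m ∈ Finset.Icc 1 j, (∑ l ∈ Finset.range m, r l) * (G Q f j m / Q j (j - 1)) := by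
  simp only [W, Finset.mul_sum, Finset.sum_mul]
  refine Finset.sum_comm' fun l m => ?_
  simp only [Finset.mem_range, Finset.mem_Icc]
  omega

/-- `(Q - g) W^{(g + c)}(·, j) = δ_j` on `{1, 2, …}`. -/
lemma generator_W (hQ : IsRateMatrix Q) (g : ℕ → ℝ) {j k : ℕ} (hk : 1 ≤ k) :
    ∑ l ∈ Finset.range j, Q k l * W Q (g + killingRate Q) l j -
      g k * W Q (g + killingRate Q) k j = if k = j then 1 else 0 := by
  set f := g + killingRate Q
  rw [sum_range_mul_W]
  -- Skip-freeness kills the partial row sums below `k` and leaves the single rate `q_{k,k-1}` at `m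
  -- = k`.
  have hlow : ∀ m < k, ∑ l ∈ Finset.range m, Q k l = 0 := fun m hm =>
    Finset.sum_eq_zero fun l hl => hQ.skip_free k l (by have := Finset.mem_range.1 hl; omega)
  have hkk : ∑ l ∈ Finset.range k, Q k l = Q k (k - 1) := by
    obtain ⟨k, rfl⟩ : ∃ k', k = k' + 1 := ⟨k - 1, by omega⟩
    rw [Finset.sum_range_succ, Nat.add_sub_cancel, Finset.sum_eq_zero, zero_add]
    exact fun l hl => hQ.skip_free _ l (by have := Finset.mem_range.1 hl; omega)
  rcases Nat.lt_or_ge j k with hjk | hkj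
  · rw [W_eq_zero Q f hjk.le, if_neg (by omega), Finset.sum_eq_zero]
    · simp
    · intro m hm
      rw [hlow m (by have := Finset.mem_Icc.1 hm; omega), zero_mul]
  · have hsub : Finset.Icc k j ⊆ Finset.Icc 1 j := Finset.Icc_subset_Icc_left hk
    rw [← Finset.sum_subset hsub fun m hm hm' => by
      rw [hlow m (by simp only [Finset.mem_Icc] at hm hm'; omega), zero_mul]]
    rw [← Finset.add_sum_Ioc_eq_sum_Icc hkj, hkk, W, Finset.mul_sum]
    have hIoc : Finset.Ioc k j = Finset.Icc (k + 1) j := by ext; simp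
    have e : ∑ m ∈ Finset.Ioc k j, (∑ l ∈ Finset.range m, Q k l) * (G Q f j m / Q j (j - 1)) =
        ∑ m ∈ Finset.Icc (k + 1) j, g k * (G Q f j m / Q j (j - 1)) -
          (∑ m ∈ Finset.Icc (k + 1) j, qTail Q f k m * G Q f j m) / Q j (j - 1) := by
      rw [hIoc, Finset.sum_div, ← Finset.sum_sub_distrib]
      refine Finset.sum_congr rfl fun m _ => ?_
      rw [sum_range_row hQ g k m]; ring
    rw [e]
    -- At `k = j` only `q_{j,j-1} G_j^{(j)} / q_{j,j-1} = 1` survives. For `k < j` the term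
    -- `q_{k,k-1} G_k^{(j)}` cancels the tail sum by the recursion for `G`.
    rcases eq_or_ne k j with rfl | hne
    · rw [G_self, if_pos rfl, Finset.Icc_eq_empty (by omega)]
      simp [(hQ.down_pos k hk).ne']
    · have hq := (hQ.down_pos k hk).ne'
      rw [if_neg hne, G_of_ne Q f hne, ← Finset.sum_div]
      field_simp
      ring

/-- By skip-freeness, row `k > a` only charges `[a, ∞)`, so a function vanishing at `a` may be summed
over `(a, N)` alone. -/
lemma sum_Ioo_eq_sum_range (hQ : IsRateMatrix Q) {a k N : ℕ} (hak : a < k) {v : ℕ → ℝ}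
    (hv : v a = 0) :
    ∑ l ∈ Finset.Ioo a N, Q k l * v l = ∑ l ∈ Finset.range N, Q k l * v l := by
  refine Finset.sum_subset (fun l hl => by simp at hl ⊢; omega) fun l hl hl' => ?_
  simp only [Finset.mem_Ioo, Finset.mem_range] at hl hl'
  rcases Nat.lt_or_ge l a with h | h
  · rw [hQ.skip_free k l (by omega), zero_mul]
  · obtain rfl : l = a := by omega
    rw [hv, mul_zero]

lemma sum_range_mul_W_of_le (Q : ℕ → ℕ → ℝ) (f r : ℕ → ℝ) {j N : ℕ} (h : j ≤ N) :
    ∑ l ∈ Finset.range N, r l * W Q f l j = ∑ l ∈ Finset.range j, r l * W Q f l j := by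
  symm
  refine Finset.sum_subset (Finset.range_mono h) fun l _ hl => ?_
  rw [W_eq_zero Q f (by simpa using hl), mul_zero]

/-- The Green function of the chain killed on leaving `(a, N)`. -/
def green (Q : ℕ → ℕ → ℝ) (g : ℕ → ℝ) (a N j i : ℕ) : ℝ :=
  W Q (g + killingRate Q) a j * W Q (g + killingRate Q) i N / W Q (g + killingRate Q) a N -
    W Q (g + killingRate Q) i j

lemma green_left (hQ : IsRateMatrix Q) {g : ℕ → ℝ} (hg : ∀ n, 1 ≤ n → 0 ≤ g n) {a N : ℕ}
    (h : a < N) (j : ℕ) : green Q g a N j a = 0 := by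
  have : 0 < W Q (g + killingRate Q) a N :=
    W_pos hQ (fun n hn => add_nonneg (hg n hn) (killingRate_nonneg hQ n)) h
  rw [green]; field_simp; ring

/-- The part `W(·, N)` is annihilated at every `k < N`, and `-W(·, j)` contributes `-δ_j`. The
coefficient of the former makes the combination vanish at `a`, so that the sum over `(a, N)` sees
the whole row below `N`. -/
lemma generator_green (hQ : IsRateMatrix Q) {g : ℕ → ℝ} (hg : ∀ n, 1 ≤ n → 0 ≤ g n)
    {a N j k : ℕ} (hjN : j < N) (hak : a < k) (hkN : k < N) :
    ∑ l ∈ Finset.Ioo a N, Q k l * green Q g a N j l - g k * green Q g a N j k =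
      -if k = j then 1 else 0 := by
  rw [sum_Ioo_eq_sum_range hQ hak (green_left hQ hg (hak.trans hkN) j)]
  have h1 := generator_W hQ g (j := N) (k := k) (by omega)
  have h2 := generator_W hQ g (j := j) (k := k) (by omega)
  rw [if_neg (by omega)] at h1
  rw [← sum_range_mul_W_of_le Q _ (Q k) hjN.le] at h2
  simp only [green]
  set f := g + killingRate Q
  have e : ∑ l ∈ Finset.range N, Q k l * (W Q f a j * W Q f l N / W Q f a N - W Q f l j) =
      W Q f a j / W Q f a N * (∑ l ∈ Finset.range N, Q k l * W Q f l N) -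
        ∑ l ∈ Finset.range N, Q k l * W Q f l j := by
    rw [Finset.mul_sum, ← Finset.sum_sub_distrib]
    exact Finset.sum_congr rfl fun l _ => by ring
  rw [e, ← h2]
  linear_combination W Q f a j / W Q f a N * h1

/-- The harmonic function `W(·, N) / W(a, N)` on `[a, N)`. -/
lemma generator_ratio (hQ : IsRateMatrix Q) (g : ℕ → ℝ) {a N k : ℕ}
    (hak : a < k) (hkN : k < N) :
    ∑ l ∈ Finset.Ico a N, Q k l *
        (W Q (g + killingRate Q) l N / W Q (g + killingRate Q) a N) -
      g k * (W Q (g + killingRate Q) k N / W Q (g + killingRate Q) a N) = 0 := by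
  have h1 := generator_W hQ g (j := N) (k := k) (by omega)
  rw [if_neg (by omega)] at h1
  set f := g + killingRate Q
  have e : ∑ l ∈ Finset.Ico a N, Q k l * (W Q f l N / W Q f a N) =
      ∑ l ∈ Finset.range N, Q k l * (W Q f l N / W Q f a N) := by
    refine Finset.sum_subset (fun l hl => by simp at hl ⊢; omega) fun l hl hl' => ?_
    simp only [Finset.mem_Ico, Finset.mem_range] at hl hl'
    rw [hQ.skip_free k l (by omega), zero_mul]
  have e' : ∑ l ∈ Finset.range N, Q k l * (W Q f l N / W Q f a N) =
      (∑ l ∈ Finset.range N, Q k l * W Q f l N) / W Q f a N := by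
    rw [Finset.sum_div]; exact Finset.sum_congr rfl fun l _ => by ring
  rw [e, e']
  linear_combination h1 / W Q f a N

end Scale

/-! ### Resolvents of substochastic semigroups -/

section Resolvent

attribute [local instance] Matrix.linftyOpNormedRing Matrix.linftyOpNormedAlgebra

variable {ι : Type*} [Fintype ι] [DecidableEq ι] {B : Matrix ι ι ℝ}

lemma hasDerivAt_exp_mulVec (B : Matrix ι ι ℝ) (x : ι → ℝ) (i : ι) (t : ℝ) :
    HasDerivAt (fun t : ℝ => (NormedSpace.exp (t • B)).mulVec x i)
      ((NormedSpace.exp (t • B)).mulVec (B.mulVec x) i) t := by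
  have h1 : HasDerivAt (fun t : ℝ => NormedSpace.exp (t • B)) (NormedSpace.exp (t • B) * B) t :=
    hasDerivAt_exp_smul_const B t
  have h2 : ∀ j, HasDerivAt (fun t : ℝ => NormedSpace.exp (t • B) i j)
      ((NormedSpace.exp (t • B) * B) i j) t := fun j =>
    hasDerivAt_pi.1 (hasDerivAt_pi.1 h1 i) j
  rw [Matrix.mulVec_mulVec]
  exact HasDerivAt.fun_sum fun j _ => (h2 j).mul_const (x j)

lemma abs_exp_mulVec_le (hM : ∀ t : ℝ, 0 ≤ t → ∀ i j, 0 ≤ NormedSpace.exp (t • B) i j)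
    (x : ι → ℝ) (i : ι) {t : ℝ} (ht : 0 ≤ t) :
    |(NormedSpace.exp (t • B)).mulVec x i| ≤ ‖x‖ * (NormedSpace.exp (t • B)).mulVec 1 i := by
  simp only [Matrix.mulVec, dotProduct, Pi.one_apply, mul_one, Finset.mul_sum]
  refine (Finset.abs_sum_le_sum_abs _ _).trans (Finset.sum_le_sum fun j _ => ?_)
  rw [abs_mul, abs_of_nonneg (hM t ht i j), mul_comm]
  exact mul_le_mul_of_nonneg_right (norm_le_pi_norm x j) (hM t ht i j)

lemma exp_mulVec_mono (hM : ∀ t : ℝ, 0 ≤ t → ∀ i j, 0 ≤ NormedSpace.exp (t • B) i j)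
    {x y : ι → ℝ} (hxy : x ≤ y) (i : ι) {t : ℝ} (ht : 0 ≤ t) :
    (NormedSpace.exp (t • B)).mulVec x i ≤ (NormedSpace.exp (t • B)).mulVec y i :=
  Finset.sum_le_sum fun j _ => mul_le_mul_of_nonneg_left (hxy j) (hM t ht i j)

lemma antitoneOn_exp_mulVec_one (hM : ∀ t : ℝ, 0 ≤ t → ∀ i j, 0 ≤ NormedSpace.exp (t • B) i j)
    (hB : B.mulVec 1 ≤ 0) (i : ι) :
    AntitoneOn (fun t : ℝ => (NormedSpace.exp (t • B)).mulVec 1 i) (Set.Ici 0) := by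
  refine antitoneOn_of_deriv_nonpos (convex_Ici 0)
    (fun t _ => (hasDerivAt_exp_mulVec B 1 i t).continuousAt.continuousWithinAt)
    (fun t _ => (hasDerivAt_exp_mulVec B 1 i t).differentiableAt.differentiableWithinAt)
    fun t ht => ?_
  rw [(hasDerivAt_exp_mulVec B 1 i t).deriv]
  have := exp_mulVec_mono hM hB i (interior_subset ht)
  simpa using this

/-- The supersolution replaces any spectral argument. With `m` the decreasing total mass, `exp (t B)
u + t m(T)` is non-increasing on `[0, T]`, so `T m(T) ≤ 2 ‖u‖` and the mass decays at least like `1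
/ T`. No sign of `u` is needed. -/
lemma tendsto_exp_mulVec_zero (hM : ∀ t : ℝ, 0 ≤ t → ∀ i j, 0 ≤ NormedSpace.exp (t • B) i j)
    (hB : B.mulVec 1 ≤ 0) {u : ι → ℝ} (hu : B.mulVec u ≤ -1) (x : ι → ℝ) (i : ι) :
    Tendsto (fun t : ℝ => (NormedSpace.exp (t • B)).mulVec x i) atTop (𝓝 0) := by
  set m : ℝ → ℝ := fun t => (NormedSpace.exp (t • B)).mulVec 1 i
  have hm0 : m 0 = 1 := by simp [m]
  have hanti := antitoneOn_exp_mulVec_one hM hB i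
  have hmle : ∀ t, 0 ≤ t → m t ≤ 1 := fun t ht => hm0 ▸ hanti Set.self_mem_Ici ht ht
  have hbound : ∀ t : ℝ, 0 < t → m t ≤ 2 * ‖u‖ / t := by
    intro T hT
    have hψ : AntitoneOn (fun t : ℝ => (NormedSpace.exp (t • B)).mulVec u i + t * m T)
        (Set.Icc 0 T) := by
      have hd : ∀ t, HasDerivAt (fun t : ℝ => (NormedSpace.exp (t • B)).mulVec u i + t * m T)
          ((NormedSpace.exp (t • B)).mulVec (B.mulVec u) i + 1 * m T) t := fun t =>
        (hasDerivAt_exp_mulVec B u i t).add ((hasDerivAt_id t).mul_const _)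
      refine antitoneOn_of_deriv_nonpos (convex_Icc 0 T)
        (fun t _ => (hd t).continuousAt.continuousWithinAt)
        (fun t _ => (hd t).differentiableAt.differentiableWithinAt) fun t ht => ?_
      have ht' := interior_subset ht
      rw [(hd t).deriv]
      have h1 := exp_mulVec_mono hM hu i ht'.1
      have h2 : m T ≤ m t := hanti ht'.1 hT.le ht'.2
      rw [Matrix.mulVec_neg, Pi.neg_apply] at h1
      linarith
    have h1 := hψ (Set.left_mem_Icc.2 hT.le) (Set.right_mem_Icc.2 hT.le) hT.le
    simp only [zero_smul, NormedSpace.exp_zero, Matrix.one_mulVec, zero_mul, add_zero] at h1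
    have h2 : |u i| ≤ ‖u‖ := norm_le_pi_norm u i
    have h3 := abs_exp_mulVec_le hM u i hT.le
    have h4 : ‖u‖ * m T ≤ ‖u‖ := mul_le_of_le_one_right (norm_nonneg _) (hmle T hT.le)
    rw [le_div_iff₀ hT]
    have h5 := abs_le.1 (h3.trans h4)
    have h6 := abs_le.1 h2
    linarith
  have hlim : Tendsto (fun t : ℝ => ‖x‖ * (2 * ‖u‖ / t)) atTop (𝓝 0) := by
    have : Tendsto (fun t : ℝ => 2 * ‖u‖ / t) atTop (𝓝 0) := tendsto_id.const_div_atTop _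
    simpa using this.const_mul ‖x‖
  refine squeeze_zero_norm' ?_ hlim
  filter_upwards [eventually_gt_atTop 0] with t ht
  exact (abs_exp_mulVec_le hM x i ht.le).trans (by gcongr; exact hbound t ht)

/-- Since `B v = -e_j`, the function `-exp (t B) v` is a primitive of the `j`-th column. Its
non-negative derivative and its limit `0` at infinity give both integrability and the value, and
hence also `v i ≥ 0`. -/
lemma lintegral_exp_eq (hM : ∀ t : ℝ, 0 ≤ t → ∀ i j, 0 ≤ NormedSpace.exp (t • B) i j)
    (hB : B.mulVec 1 ≤ 0) {u : ι → ℝ} (hu : B.mulVec u ≤ -1) {v : ι → ℝ} {j : ι}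
    (hv : B.mulVec v = -Pi.single j 1) (i : ι) :
    ∫⁻ t in Set.Ioi (0 : ℝ), ENNReal.ofReal (NormedSpace.exp (t • B) i j) =
      ENNReal.ofReal (v i) ∧ 0 ≤ v i := by
  have hd : ∀ t ∈ Set.Ici (0 : ℝ), HasDerivAt (fun t : ℝ => -(NormedSpace.exp (t • B)).mulVec v i)
      (NormedSpace.exp (t • B) i j) t := fun t _ => by
    have := (hasDerivAt_exp_mulVec B v i t).neg
    rw [hv, Matrix.mulVec_neg, Pi.neg_apply, neg_neg, Matrix.mulVec_single_one] at this
    exact this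
  have hnn : ∀ t ∈ Set.Ioi (0 : ℝ), 0 ≤ NormedSpace.exp (t • B) i j := fun t ht =>
    hM t (le_of_lt ht) i j
  have hlim : Tendsto (fun t : ℝ => -(NormedSpace.exp (t • B)).mulVec v i) atTop (𝓝 0) := by
    simpa using (tendsto_exp_mulVec_zero hM hB hu v i).neg
  have hint := integrableOn_Ioi_deriv_of_nonneg' hd hnn hlim
  have hval := integral_Ioi_of_hasDerivAt_of_nonneg' hd hnn hlim
  rw [← ofReal_integral_eq_lintegral_ofReal hint
    ((ae_restrict_iff' measurableSet_Ioi).2 (ae_of_all _ hnn))]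
  simp only [zero_smul, NormedSpace.exp_zero, Matrix.one_mulVec, zero_sub, neg_neg] at hval
  exact ⟨by rw [hval], hval ▸ setIntegral_nonneg measurableSet_Ioi hnn⟩

end Resolvent

end

/-! ### Exit from finite sets of states. -/

section

/-! ### Grid times and exit times -/

section Exit

variable {Ω : Type*} {X : ℝ≥0 → Ω → Option ℕ}

/-- Times of the form `k / (n + 1)`. -/
def gridTime (p : ℕ × ℕ) : ℝ≥0 := (p.1 : ℝ≥0) * (1 / ((p.2 : ℝ≥0) + 1))

/-- The extra `+ 1` in the index keeps the grid times strictly positive, as the Feynman–Kac formula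
is available only for `t > 0`. -/
lemma tendsto_gridTime (s : ℝ≥0) :
    Tendsto (fun n : ℕ => gridTime (⌈s / (1 / ((n : ℝ≥0) + 1))⌉₊ + 1, n)) atTop (𝓝[≥] s) := by
  have hpos : ∀ n : ℕ, 0 < 1 / ((n : ℝ≥0) + 1) := fun n => by positivity
  have h := tendsto_nhdsWithin_iff.1 (tendsto_ceil_div_mul hpos (tendsto_div_succ 1) s)
  have e : ∀ n : ℕ, gridTime (⌈s / (1 / ((n : ℝ≥0) + 1))⌉₊ + 1, n) =
      (⌈s / (1 / ((n : ℝ≥0) + 1))⌉₊ : ℝ≥0) * (1 / ((n : ℝ≥0) + 1)) + 1 / ((n : ℝ≥0) + 1) :=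
    fun n => by simp only [gridTime]; push_cast; ring
  simp_rw [e]
  refine tendsto_nhdsWithin_iff.2 ⟨by simpa using h.1.add (tendsto_div_succ 1), ?_⟩
  exact h.2.mono fun n hn => Set.mem_Ici.2 (le_add_right hn)

lemma gridTime_pos (k n : ℕ) : 0 < gridTime (k + 1, n) := by
  simp only [gridTime]; positivity

/-- Replacing the uncountable infimum by a countable one is what makes entrance times measurable. -/
lemma entryTime_eq_iInf_gridTime {w : Ω} (hr : RightConst fun t => X t w) (F : Set (Option ℕ)) :
    entryTime X F w = ⨅ (p : ℕ × ℕ) (_ : X (gridTime p) w ∈ F), (gridTime p : ℝ≥0∞) := by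
  refine le_antisymm (le_iInf₂ fun p hp => iInf₂_le (gridTime p) hp) (le_iInf₂ fun s hs => ?_)
  have h1 : Tendsto (fun n : ℕ => (gridTime (⌈s / (1 / ((n : ℝ≥0) + 1))⌉₊ + 1, n) : ℝ≥0∞)) atTop
      (𝓝 (s : ℝ≥0∞)) :=
    ENNReal.tendsto_coe.2 (tendsto_nhdsWithin_iff.1 (tendsto_gridTime s)).1
  refine ge_of_tendsto h1 ?_
  filter_upwards [(tendsto_gridTime s).eventually (hr s)] with n hn
  exact iInf₂_le _ (by rw [hn]; exact hs)

/-- The first exit time from `S ⊆ E`. -/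
def exitTime (X : ℝ≥0 → Ω → Option ℕ) (S : Finset ℕ) (w : Ω) : ℝ≥0∞ :=
  entryTime X (some '' (S : Set ℕ))ᶜ w

lemma lt_exitTime_iff {w : Ω} (hr : RightConst fun t => X t w) (S : Finset ℕ) (t : ℝ≥0) :
    (t : ℝ≥0∞) < exitTime X S w ↔ ∀ s ≤ t, X s w ∈ some '' (S : Set ℕ) := by
  rw [exitTime, lt_entryTime_iff hr]; simp only [Set.notMem_compl_iff]

lemma exists_of_lt_exitTime {w : Ω} (hr : RightConst fun t => X t w) {S : Finset ℕ} {t : ℝ≥0}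
    (h : (t : ℝ≥0∞) < exitTime X S w) : ∃ l ∈ S, X t w = some l := by
  obtain ⟨l, hl, hx⟩ := (lt_exitTime_iff hr S t).1 h t le_rfl
  exact ⟨l, hl, hx.symm⟩

lemma min_hitTime_eq_exitTime (X : ℝ≥0 → Ω → Option ℕ) (a N : ℕ) (w : Ω) :
    min (hitTime X a w) (min (passTime X N w) (killTime X w)) =
      exitTime X ((Finset.range N).erase a) w := by
  rw [hitTime, passTime, killTime, ← entryTime_union, ← entryTime_union, exitTime]
  congr 1
  ext o
  rcases o with _ | l
  · simp
  · simp; omega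

lemma min_passTime_eq_exitTime (X : ℝ≥0 → Ω → Option ℕ) (N : ℕ) (w : Ω) :
    min (passTime X N w) (killTime X w) = exitTime X (Finset.range N) w := by
  rw [passTime, killTime, ← entryTime_union, exitTime]
  congr 1
  ext o
  rcases o with _ | l
  · simp
  · simp

end Exit

/-! ### Measurability -/

section Measurability

variable {Ω : Type*} [MeasurableSpace Ω] {Q : ℕ → ℕ → ℝ} {X : ℝ≥0 → Ω → Option ℕ}
  {P : ℕ → Measure Ω} {α : Type*} [MeasurableSpace α]

lemma measurable_timeIntegral {F : α → ℝ≥0 → ℝ≥0∞} (hF : Measurable (Function.uncurry F))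
    {T : α → ℝ≥0∞} (hT : Measurable T) : Measurable fun a => timeIntegral (T a) (F a) := by
  have h1 : ∀ a, timeIntegral (T a) (F a) = ∫⁻ t : ℝ,
      {p : α × ℝ | 0 ≤ p.2 ∧ ENNReal.ofReal p.2 < T p.1}.indicator
        (fun p => F p.1 p.2.toNNReal) (a, t) := fun a => by
    rw [timeIntegral, ← lintegral_indicator (measurableSet_timeSet _)]
    rfl
  simp_rw [h1]
  refine Measurable.lintegral_prod_right' ?_
  refine Measurable.indicator ?_ ?_
  · exact hF.comp (measurable_fst.prodMk (measurable_real_toNNReal.comp measurable_snd))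
  · exact (measurableSet_le measurable_const measurable_snd).inter
      (measurableSet_lt (ENNReal.measurable_ofReal.comp measurable_snd) (hT.comp measurable_fst))

lemma IsKilledChain.measurable_uncurry (hX : IsKilledChain Q X P) (u : Option ℕ → ℝ≥0∞) :
    Measurable fun p : ℝ≥0 × Ω => u (X p.1 p.2) :=
  measurable_uncurry_of_rightConst (f := fun t w => u (X t w)) (fun t => hX.measurable_comp t u)
    fun w => (hX.rightConst w).comp u

lemma measurable_discount (hX : IsKilledChain Q X P) (g : ℕ → ℝ) {T : α → ℝ≥0∞}
    (hT : Measurable T) {p : α → Ω} (hp : Measurable p) :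
    Measurable fun a => discount g X (T a) (p a) := by
  refine measurable_negExp.comp (measurable_timeIntegral ?_ hT)
  exact (hX.measurable_uncurry fun o => ENNReal.ofReal (o.elim 0 g)).comp
    (measurable_snd.prodMk (hp.comp measurable_fst))

lemma measurableSet_apply_eq (hX : IsKilledChain Q X P) (x : Option ℕ) :
    MeasurableSet {p : ℝ≥0 × Ω | X p.1 p.2 = x} := by
  have := hX.measurable_uncurry (fun o => if o = x then 1 else 0) (measurableSet_singleton 1)
  convert this using 1
  ext p
  simp

lemma measurable_indicator_discount (hX : IsKilledChain Q X P) (g : ℕ → ℝ) (x : Option ℕ) :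
    Measurable (Function.uncurry fun (w : Ω) (t : ℝ≥0) =>
      {t : ℝ≥0 | X t w = x}.indicator (fun t => discount g X (t : ℝ≥0∞) w) t) := by
  have h1 : Measurable fun p : Ω × ℝ≥0 => discount g X (p.2 : ℝ≥0∞) p.1 :=
    measurable_discount hX g (measurable_coe_nnreal_ennreal.comp measurable_snd) measurable_fst
  have h2 : MeasurableSet {p : Ω × ℝ≥0 | X p.2 p.1 = x} :=
    measurable_swap (measurableSet_apply_eq hX x)
  exact h1.indicator h2

lemma measurable_entryTime (hX : IsKilledChain Q X P) (F : Set (Option ℕ)) :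
    Measurable (entryTime X F) := by
  have h : entryTime X F =
      fun w => ⨅ (p : ℕ × ℕ) (_ : X (gridTime p) w ∈ F), (gridTime p : ℝ≥0∞) :=
    funext fun w => entryTime_eq_iInf_gridTime (hX.rightConst w) F
  rw [h]
  refine Measurable.iInf fun p => ?_
  exact hX.measurable_comp (gridTime p) fun o => ⨅ (_ : o ∈ F), (gridTime p : ℝ≥0∞)

end Measurability

/-! ### The Green function -/

variable {Ω : Type*} [MeasurableSpace Ω] {Q : ℕ → ℕ → ℝ} {X : ℝ≥0 → Ω → Option ℕ}
  {P : ℕ → Measure Ω}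

lemma genMatrix_mulVec (Q : ℕ → ℕ → ℝ) (g : ℕ → ℝ) (S : Finset ℕ) (v : ℕ → ℝ) (k : S) :
    (genMatrix Q g S).mulVec (fun l : S => v l) k = ∑ l ∈ S, Q k l * v l - g k * v k := by
  simp only [Matrix.mulVec, dotProduct, genMatrix, sub_mul, Finset.sum_sub_distrib, ite_mul,
    zero_mul, Finset.sum_ite_eq, Finset.mem_univ, if_true]
  rw [Finset.sum_coe_sort S fun l => Q k l * v l]

/-- The occupation density of the chain killed on leaving `S`, from a supersolution `u` and the
solution `v` of the Poisson equation. -/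
lemma lintegral_occupation (hQ : IsRateMatrix Q) (hX : IsKilledChain Q X P) {S : Finset ℕ}
    {g : ℕ → ℝ} (hg : ∀ l ∈ S, 0 ≤ g l) {u v : ℕ → ℝ} {i j : ℕ} (hi : i ∈ S) (hj : j ∈ S)
    (hu : ∀ k ∈ S, ∑ l ∈ S, Q k l * u l - g k * u k ≤ -1)
    (hv : ∀ k ∈ S, ∑ l ∈ S, Q k l * v l - g k * v k = -if k = j then 1 else 0) :
    ∫⁻ w, timeIntegral (exitTime X S w) (fun t => {t : ℝ≥0 | X t w = some j}.indicator
      (fun t => discount g X (t : ℝ≥0∞) w) t) ∂(P i) = ENNReal.ofReal (v i) ∧ 0 ≤ v i := by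
  have := hX.prob
  set B := genMatrix Q g S
  -- The entries of `exp (t B)` are non-negative because they are expectations.
  have hM : ∀ t : ℝ, 0 ≤ t → ∀ k l : S, 0 ≤ NormedSpace.exp (t • B) k l := by
    intro t ht k l
    rcases ht.eq_or_lt with rfl | ht
    · simp only [zero_smul, NormedSpace.exp_zero, Matrix.one_apply]; split_ifs <;> simp
    · lift t to ℝ≥0 using ht.le
      exact (lintegral_discount_stay hX hg (by exact_mod_cast ht) k l).2
  have hB : B.mulVec 1 ≤ 0 := fun k => by
    have h1 := genMatrix_mulVec Q g S (fun _ => 1) k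
    simp only [mul_one] at h1
    have h2 : ∑ l ∈ S, Q k l ≤ 0 := ((hQ.summable k).sum_le_tsum S fun l hl =>
      hQ.nonneg k l fun h => hl (h ▸ k.2)).trans (hQ.row_sum_le k)
    have h3 := hg k k.2
    change B.mulVec (fun _ => 1) k ≤ 0
    rw [h1]; linarith
  have hu' : B.mulVec (fun l : S => u l) ≤ -1 := fun k => by
    rw [genMatrix_mulVec]; exact hu k k.2
  have hv' : B.mulVec (fun l : S => v l) = -Pi.single ⟨j, hj⟩ 1 := by
    funext k
    rw [genMatrix_mulVec, hv k k.2, Pi.neg_apply, Pi.single_apply]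
    congr 2
    rw [Subtype.ext_iff]
  have hres := lintegral_exp_eq hM hB hu' hv' ⟨i, hi⟩
  refine ⟨?_, hres.2⟩
  rw [← hres.1]
  simp_rw [timeIntegral_eq_lintegral_indicator]
  rw [lintegral_lintegral_swap]
  -- After Tonelli the null time `t = 0` is dropped, and Feynman–Kac applies at every remaining `t`.
  · rw [setLIntegral_congr Ioi_ae_eq_Ici.symm]
    refine setLIntegral_congr_fun measurableSet_Ioi fun t ht => ?_
    have ht' : (0 : ℝ) < t := ht
    lift t to ℝ≥0 using ht'.le
    rw [← (lintegral_discount_stay hX hg (by exact_mod_cast ht') ⟨i, hi⟩ ⟨j, hj⟩).1]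
    refine lintegral_congr fun w => ?_
    rw [Real.toNNReal_coe]
    have hlt := lt_exitTime_iff (hX.rightConst w) S t
    by_cases h1 : (t : ℝ≥0∞) < exitTime X S w
    · rw [Set.indicator_of_mem (by exact h1)]
      by_cases h2 : X t w = some j
      · rw [Set.indicator_of_mem (by exact h2), Set.indicator_of_mem (by exact ⟨hlt.1 h1, h2⟩)]
      · rw [Set.indicator_of_notMem (by exact h2), Set.indicator_of_notMem fun H => h2 H.2]
    · rw [Set.indicator_of_notMem (by exact h1), Set.indicator_of_notMem fun H => h1 (hlt.2 H.1)]
  · refine Measurable.aemeasurable ?_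
    have h1 := (measurable_indicator_discount hX g (some j)).comp
      (measurable_fst.prodMk (measurable_real_toNNReal.comp measurable_snd) :
        Measurable fun p : Ω × ℝ => (p.1, p.2.toNNReal))
    have h2 : MeasurableSet {p : Ω × ℝ | ((p.2.toNNReal : ℝ≥0) : ℝ≥0∞) < exitTime X S p.1} :=
      measurableSet_lt (measurable_coe_nnreal_ennreal.comp
        (measurable_real_toNNReal.comp measurable_snd))
        ((measurable_entryTime hX _).comp measurable_fst)
    exact h1.indicator h2

/-! ### Downward skip-freeness -/

/-- Once `a` is removed, no rate leads from above `a` to below it, and the semigroup on `S` inherits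
this. So at each fixed time the chain is below `a`, without having left `S`, with probability `0`;
countably many grid times and right-continuity extend this to all times. -/
lemma ae_exitTime_Ioo_eq (hQ : IsRateMatrix Q) (hX : IsKilledChain Q X P) {a i N : ℕ}
    (hai : a < i) (hiN : i < N) :
    ∀ᵐ w ∂(P i), exitTime X (Finset.Ioo a N) w = exitTime X ((Finset.range N).erase a) w := by
  set S := (Finset.range N).erase a
  have hiS : i ∈ S := by simp [S]; omega
  have hnull : ∀ t : ℝ≥0, 0 < t → ∀ j ∈ S, j < a →
      ∀ᵐ w ∂(P i), ¬ ((∀ s ≤ t, X s w ∈ some '' (S : Set ℕ)) ∧ X t w = some j) := by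
    intro t ht j hj hja
    have h1 := (lintegral_discount_stay hX (g := 0) (fun _ _ => le_rfl) ht ⟨i, hiS⟩ ⟨j, hj⟩).1
    -- The two blocks are the states below and above `a`; a block-triangular matrix has a
    -- block-triangular exponential.
    have hblock : ((t : ℝ) • genMatrix Q 0 S).BlockTriangular
        (fun k : S => if (k : ℕ) < a then (0 : ℕ) else 1) := by
      intro k l hkl
      have hk : a < k ∧ (l : ℕ) < a := by
        have := (Finset.mem_erase.1 k.2).1
        by_cases h1 : (k : ℕ) < a <;> by_cases h2 : (l : ℕ) < a <;> simp [h1, h2] at hkl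
        omega
      simp only [Matrix.smul_apply, genMatrix, Pi.zero_apply, ite_self, sub_zero,
        hQ.skip_free k l (by omega), smul_zero]
    have hzero : NormedSpace.exp ((t : ℝ) • genMatrix Q 0 S) ⟨i, hiS⟩ ⟨j, hj⟩ = 0 :=
      hblock.exp (by simp [hja, not_lt.2 hai.le])
    have hdisc : ∀ w, discount 0 X t w = 1 := fun w => by
      change negExp _ = 1
      rw [timeIntegral_congr (g := fun _ => 0)]
      · simp [timeIntegral, negExp_zero]
      · intro s _
        rcases X s w with _ | l <;> simp
    simp_rw [hzero, hdisc, ENNReal.ofReal_zero] at h1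
    have hm : MeasurableSet {w | (∀ s ≤ t, X s w ∈ some '' (S : Set ℕ)) ∧ X t w = some j} := by
      have : {w | (∀ s ≤ t, X s w ∈ some '' (S : Set ℕ)) ∧ X t w = some j} =
          {w | (t : ℝ≥0∞) < exitTime X S w} ∩ {w | X t w = some j} := by
        ext w
        exact and_congr_left' (lt_exitTime_iff (hX.rightConst w) S t).symm
      rw [this]
      exact (measurableSet_lt measurable_const (measurable_entryTime hX _)).inter
        (hX.measurable _ _)
    rw [ae_iff]
    simp only [not_not]
    rw [← lintegral_indicator_one hm]
    exact h1
  have hae : ∀ᵐ w ∂(P i), ∀ (p : ℕ × ℕ), ∀ j ∈ S, j < a →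
      ¬ ((∀ s ≤ gridTime (p.1 + 1, p.2), X s w ∈ some '' (S : Set ℕ)) ∧
        X (gridTime (p.1 + 1, p.2)) w = some j) := by
    refine ae_all_iff.2 fun p => ae_all_iff.2 fun j => ?_
    by_cases hj : j ∈ S
    · by_cases hja : j < a
      · filter_upwards [hnull _ (gridTime_pos p.1 p.2) j hj hja] with w hw _ _ using hw
      · simp [hja]
    · simp [hj]
  filter_upwards [hae] with w hw
  have hr := hX.rightConst w
  refine le_antisymm ?_ (ENNReal.le_of_forall_nnreal_lt fun t ht => le_of_lt ?_)
  · refine ENNReal.le_of_forall_nnreal_lt fun t ht => le_of_lt ?_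
    rw [lt_exitTime_iff hr] at ht ⊢
    refine fun s hs => Set.image_mono (fun l hl => ?_) (ht s hs)
    simp [S] at hl ⊢; omega
  · rw [lt_exitTime_iff hr]
    intro s hs
    have hsS : (s : ℝ≥0∞) < exitTime X S w := lt_of_le_of_lt (by exact_mod_cast hs) ht
    obtain ⟨l, hl, hxl⟩ := exists_of_lt_exitTime hr hsS
    refine ⟨l, ?_, hxl.symm⟩
    have hla : ¬ l < a := fun hla => by
      have h1 : ∀ᶠ q : ℝ≥0 in 𝓝[≥] s, (q : ℝ≥0∞) < exitTime X S w :=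
        nhdsWithin_le_nhds ((ENNReal.continuous_coe.tendsto s).eventually (gt_mem_nhds hsS))
      obtain ⟨n, hn1, hn2⟩ := ((tendsto_gridTime s).eventually (h1.and (hr s))).exists
      exact hw (_, n) l hl hla ⟨(lt_exitTime_iff hr S _).1 hn1, hn2.trans hxl⟩
    simp [S] at hl ⊢; omega

end

/-! ### Hitting times as limits of strong killing at one state. -/

section

/-! ### Large killing rate at a point -/

section LargeKilling

variable {Ω : Type*} {X : ℝ≥0 → Ω → Option ℕ}

/-- A visit to `a` before `T` lasts for a positive time, by right-continuity. -/
lemma timeIntegral_indicator_pos {w : Ω} (hr : RightConst fun t => X t w) {a : ℕ} {t : ℝ≥0}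
    (ht : X t w = some a) {T : ℝ≥0∞} (hT : (t : ℝ≥0∞) < T) :
    timeIntegral T (fun s => if X s w = some a then 1 else 0) ≠ 0 := by
  obtain ⟨u, hu, hmem⟩ : ∃ u > t, ∀ s ∈ Set.Ico t u, X s w = X t w := by
    have := hr t
    rwa [eventually_iff, mem_nhdsGE_iff_exists_Ico_subset] at this
  obtain ⟨r, htr, hrT⟩ := ENNReal.lt_iff_exists_nnreal_btwn.1 hT
  have htr' : t < r := by exact_mod_cast htr
  set b := min u r
  have htb : t < b := lt_min hu htr'
  have h1 : (∫⁻ _ in Set.Ico (t : ℝ) b, (1 : ℝ≥0∞)) ≤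
      timeIntegral T (fun s => if X s w = some a then 1 else 0) := by
    have hsub : Set.Ico (t : ℝ) b ⊆ {s : ℝ | 0 ≤ s ∧ ENNReal.ofReal s < T} := by
      rintro s ⟨hs1, hs2⟩
      refine ⟨t.coe_nonneg.trans hs1, lt_trans ?_ hrT⟩
      rw [← ENNReal.ofReal_coe_nnreal,
        ENNReal.ofReal_lt_ofReal_iff_of_nonneg (t.coe_nonneg.trans hs1)]
      exact hs2.trans_le (by exact_mod_cast min_le_right u r)
    refine le_trans (setLIntegral_mono' measurableSet_Ico fun s hs => ?_) (lintegral_mono_set hsub)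
    have hs0 : 0 ≤ s := t.coe_nonneg.trans hs.1
    dsimp only
    rw [hmem s.toNNReal ⟨NNReal.le_toNNReal_of_coe_le hs.1, ?_⟩, ht, if_pos rfl]
    rw [← NNReal.coe_lt_coe, Real.coe_toNNReal _ hs0]
    exact hs.2.trans_le (by exact_mod_cast min_le_left u r)
  have h2 : (∫⁻ _ in Set.Ico (t : ℝ) b, (1 : ℝ≥0∞)) = ENNReal.ofReal ((b : ℝ) - t) := by simp
  rw [h2] at h1
  refine (lt_of_lt_of_le (ENNReal.ofReal_pos.2 (sub_pos.2 ?_)) h1).ne'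
  exact_mod_cast htb

/-- If `δ > 0` is the time spent at `a` before `T`, the discount is at most `e^{-nδ}`. -/
lemma tendsto_discount_update (g : ℕ → ℝ) {w : Ω} (hr : RightConst fun t => X t w) {a : ℕ}
    {t : ℝ≥0} (ht : X t w = some a) {T : ℝ≥0∞} (hT : (t : ℝ≥0∞) < T) :
    Tendsto (fun n : ℕ => discount (Function.update g a n) X T w) atTop (𝓝 0) := by
  set δ := timeIntegral T (fun s => if X s w = some a then 1 else 0)
  have hδ : δ ≠ 0 := timeIntegral_indicator_pos hr ht hT
  have h1 : Tendsto (fun n : ℕ => negExp ((n : ℝ≥0∞) * δ)) atTop (𝓝 0) := by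
    have : Tendsto (fun n : ℕ => (n : ℝ≥0∞) * δ) atTop (𝓝 ⊤) := by
      simpa [ENNReal.top_mul hδ] using
        ENNReal.Tendsto.mul_const ENNReal.tendsto_nat_nhds_top (Or.inl ENNReal.top_ne_zero) (b := δ)
    simpa [negExp_top, Function.comp_def] using (continuous_negExp.tendsto _).comp this
  refine tendsto_of_tendsto_of_tendsto_of_le_of_le tendsto_const_nhds h1 (fun _ => zero_le)
    fun n => negExp_antitone ?_
  change (n : ℝ≥0∞) * δ ≤ _
  rw [← timeIntegral_const_mul _ (ENNReal.natCast_ne_top n)]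
  refine timeIntegral_mono fun s _ => ?_
  split_ifs with h
  · simp [h]
  · simp

lemma discount_update_of_lt_hitTime (g : ℕ → ℝ) {w : Ω} {a : ℕ} (r : ℝ) {T : ℝ≥0∞}
    (hT : T ≤ hitTime X a w) :
    discount (Function.update g a r) X T w = discount g X T w := by
  refine congrArg negExp (timeIntegral_congr fun s hs => ?_)
  have hne : X s w ≠ some a := fun h => absurd (hs.trans_le hT) (not_lt.2 (iInf₂_le s h))
  rcases hx : X s w with _ | l
  · rfl
  · have : l ≠ a := fun h => hne (by rw [hx, h])
    simp [this]

end LargeKilling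

variable {Ω : Type*} [MeasurableSpace Ω] {Q : ℕ → ℕ → ℝ} {X : ℝ≥0 → Ω → Option ℕ}
  {P : ℕ → Measure Ω}

/-! ### Discounted functionals up to an exit time -/

lemma timeIntegral_mul_discount (hX : IsKilledChain Q X P) {S : Finset ℕ} {g : ℕ → ℝ}
    (hg : ∀ l ∈ S, 0 ≤ g l) {w : Ω} {T : ℝ≥0∞} (hT : T ≤ exitTime X S w) :
    timeIntegral T (fun s => ENNReal.ofReal ((X s w).elim 0 g) * discount g X s w) +
      discount g X T w = 1 := by
  refine timeIntegral_mul_negExp ((hX.rightConst w).comp fun o => o.elim 0 g)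
    (C := ∑ l ∈ S, |g l|) (fun s hs => ?_) fun s hs => ?_
  all_goals obtain ⟨l, hl, hxl⟩ := exists_of_lt_exitTime (hX.rightConst w) (hs.trans_le hT)
  · simpa [hxl] using hg l hl
  · simp only [hxl, Option.elim_some]
    exact (le_abs_self _).trans
      (Finset.single_le_sum (f := fun l => |g l|) (fun _ _ => abs_nonneg _) hl)

lemma measurable_exitTime (hX : IsKilledChain Q X P) (S : Finset ℕ) :
    Measurable (exitTime X S) := measurable_entryTime hX _

lemma measurable_discount_time (hX : IsKilledChain Q X P) (g : ℕ → ℝ) (w : Ω) :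
    Measurable fun t : ℝ≥0 => discount g X t w :=
  measurable_discount hX g measurable_coe_nnreal_ennreal measurable_const

lemma measurable_path (hX : IsKilledChain Q X P) (u : Option ℕ → ℝ≥0∞) (w : Ω) :
    Measurable fun t : ℝ≥0 => u (X t w) :=
  ((hX.rightConst w).comp u).measurable

/-- The sum of the Green functions over their sources provides the supersolution that
`lintegral_occupation` requires. -/
lemma generator_sum_green (hQ : IsRateMatrix Q) {g : ℕ → ℝ} (hg : ∀ n, 1 ≤ n → 0 ≤ g n)
    {a N k : ℕ} (hak : a < k) (hkN : k < N) :
    ∑ l ∈ Finset.Ioo a N, Q k l * (∑ j ∈ Finset.Ioo a N, green Q g a N j l) -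
      g k * ∑ j ∈ Finset.Ioo a N, green Q g a N j k = -1 := by
  simp_rw [Finset.mul_sum]
  rw [Finset.sum_comm, ← Finset.sum_sub_distrib]
  have h1 : ∀ j ∈ Finset.Ioo a N, ∑ l ∈ Finset.Ioo a N, Q k l * green Q g a N j l -
      g k * green Q g a N j k = -if k = j then 1 else 0 := fun j hj =>
    generator_green hQ hg (Finset.mem_Ioo.1 hj).2 hak hkN
  rw [Finset.sum_congr rfl h1, Finset.sum_neg_distrib, Finset.sum_ite_eq,
    if_pos (Finset.mem_Ioo.2 ⟨hak, hkN⟩)]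

lemma lintegral_occupation_Ioo (hQ : IsRateMatrix Q) (hX : IsKilledChain Q X P) {g : ℕ → ℝ}
    (hg : ∀ n, 1 ≤ n → 0 ≤ g n) {a i j N : ℕ} (hai : a < i) (hiN : i < N) (haj : a < j)
    (hjN : j < N) :
    ∫⁻ w, timeIntegral (exitTime X (Finset.Ioo a N) w) (fun t =>
      {t : ℝ≥0 | X t w = some j}.indicator (fun t => discount g X (t : ℝ≥0∞) w) t) ∂(P i) =
        ENNReal.ofReal (green Q g a N j i) ∧ 0 ≤ green Q g a N j i := by
  refine lintegral_occupation hQ hX (u := fun k => ∑ j ∈ Finset.Ioo a N, green Q g a N j k)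
    (v := green Q g a N j) (fun l hl => hg l ?_) (Finset.mem_Ioo.2 ⟨hai, hiN⟩)
    (Finset.mem_Ioo.2 ⟨haj, hjN⟩) (fun k hk => ?_) fun k hk => ?_
  · have := Finset.mem_Ioo.1 hl; omega
  · have := Finset.mem_Ioo.1 hk
    exact (generator_sum_green hQ hg this.1 this.2).le
  · have := Finset.mem_Ioo.1 hk
    exact generator_green hQ hg hjN this.1 this.2

/-- `∑_{j ∈ S} g_j 1_{X_t = j} = g(X_t)` before the exit from `S`. -/
lemma timeIntegral_mul_discount_eq_sum (hX : IsKilledChain Q X P) (S : Finset ℕ) (g : ℕ → ℝ)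
    (w : Ω) :
    timeIntegral (exitTime X S w)
        (fun s => ENNReal.ofReal ((X s w).elim 0 g) * discount g X s w) =
      ∑ j ∈ S, ENNReal.ofReal (g j) * timeIntegral (exitTime X S w)
        (fun t => {t : ℝ≥0 | X t w = some j}.indicator
          (fun t => discount g X (t : ℝ≥0∞) w) t) := by
  have hm : ∀ j, Measurable fun t : ℝ => {t : ℝ≥0 | X t w = some j}.indicator
      (fun t => discount g X (t : ℝ≥0∞) w) t.toNNReal := fun j =>
    (measurable_indicator_discount hX g (some j)).comp
      (measurable_const.prodMk measurable_real_toNNReal :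
        Measurable fun t : ℝ => (w, t.toNNReal))
  simp_rw [← timeIntegral_const_mul _ ENNReal.ofReal_ne_top]
  rw [timeIntegral_congr (g := fun t => ∑ j ∈ S, ENNReal.ofReal (g j) *
    {t : ℝ≥0 | X t w = some j}.indicator (fun t => discount g X (t : ℝ≥0∞) w) t)]
  · exact lintegral_finsetSum _ fun j _ => (hm j).const_mul _
  · intro t ht
    obtain ⟨l, hl, hxl⟩ := exists_of_lt_exitTime (hX.rightConst w) ht
    rw [Finset.sum_eq_single l]
    · rw [Set.indicator_of_mem (by exact hxl), hxl]; rfl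
    · intro b _ hb
      rw [Set.indicator_of_notMem, mul_zero]
      intro h
      exact hb (Option.some_injective _ (Eq.trans (Eq.symm h) hxl))
    · exact fun h => absurd hl h

/-! ### The Laplace transform of the hitting time -/

/-- As the killing rate at `a` tends to infinity, the discounted killing at `a` before the exit from
`S` concentrates at the hitting time of `a`. -/
lemma tendsto_killing_at (hX : IsKilledChain Q X P) {S : Finset ℕ} {a : ℕ} (ha : a ∈ S)
    {g : ℕ → ℝ} (hg : ∀ l ∈ S, l ≠ a → 0 ≤ g l) (w : Ω) :
    Tendsto (fun n : ℕ => (n : ℝ≥0∞) * timeIntegral (exitTime X S w)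
      (fun t => {t : ℝ≥0 | X t w = some a}.indicator
        (fun t => discount (Function.update g a n) X (t : ℝ≥0∞) w) t)) atTop
      (𝓝 ({w | hitTime X a w < exitTime X S w}.indicator
        (fun w => discount g X (hitTime X a w) w) w)) ∧
    ∀ n : ℕ, (n : ℝ≥0∞) * timeIntegral (exitTime X S w)
      (fun t => {t : ℝ≥0 | X t w = some a}.indicator
        (fun t => discount (Function.update g a n) X (t : ℝ≥0∞) w) t) ≤ 1 := by
  have hr := hX.rightConst w
  set σ := exitTime X S w
  set D : ℕ → ℝ≥0 → ℝ≥0∞ := fun n t => discount (Function.update g a n) X (t : ℝ≥0∞) w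
  set J : ℕ → ℝ≥0∞ := fun n => (n : ℝ≥0∞) * timeIntegral σ
    (fun t => {t : ℝ≥0 | X t w = some a}.indicator (fun t => D n t) t)
  -- `F n` is the density of the discounted killing in `S \ {a}`
  set F : ℕ → ℝ≥0 → ℝ≥0∞ := fun n t =>
    (fun o : Option ℕ => if o = some a then 0 else ENNReal.ofReal (o.elim 0 g)) (X t w) * D n t
  have hgn : ∀ n : ℕ, ∀ l ∈ S, 0 ≤ Function.update g a (n : ℝ) l := fun n l hl => by
    rcases eq_or_ne l a with rfl | h
    · simp
    · simpa [h] using hg l hl h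
  have hDm : ∀ n, Measurable (D n) := fun n => measurable_discount_time hX _ w
  have hFm : ∀ n, Measurable (F n) := fun n => (measurable_path hX
    (fun o => if o = some a then 0 else ENNReal.ofReal (o.elim 0 g)) w).mul (hDm n)
  -- Conservation of mass: discounted killing at `a`, discounted killing elsewhere in `S`, and
  -- survival up to the exit add up to `1`.
  have hsum : ∀ n, J n + (timeIntegral σ (F n) +
      discount (Function.update g a n) X σ w) = 1 := by
    intro n
    rw [← timeIntegral_mul_discount hX (hgn n) (w := w) (T := σ) le_rfl, ← add_assoc]
    congr 1
    simp only [J]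
    rw [← timeIntegral_const_mul _ (ENNReal.natCast_ne_top n)]
    have hm1 : Measurable fun t : ℝ => (n : ℝ≥0∞) *
        {t : ℝ≥0 | X t w = some a}.indicator (fun t => D n t) t.toNNReal :=
      ((measurable_indicator_discount hX _ (some a)).comp
        (measurable_const.prodMk measurable_real_toNNReal :
          Measurable fun t : ℝ => (w, t.toNNReal))).const_mul _
    refine (lintegral_add_left hm1 _).symm.trans ?_
    refine timeIntegral_congr (f := fun t => (n : ℝ≥0∞) *
      {t : ℝ≥0 | X t w = some a}.indicator (fun t => D n t) t + F n t) fun t ht => ?_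
    by_cases h : X t w = some a
    · rw [Set.indicator_of_mem (by exact h)]
      simp [F, D, h]
    · rw [Set.indicator_of_notMem (by exact h)]
      rcases hx : X t w with _ | l
      · simp [F, hx]
      · have hl : l ≠ a := fun e => h (by rw [hx, e])
        simp [F, D, hx, hl]
  refine ⟨?_, fun n => (le_add_right le_rfl).trans (hsum n).le⟩
  by_cases hlt : hitTime X a w < σ
  · rw [Set.indicator_of_mem (by exact hlt)]
    obtain ⟨t₀, ht₀⟩ : ∃ t₀ : ℝ≥0, hitTime X a w = t₀ :=
      ⟨_, (ENNReal.coe_toNNReal (ne_top_of_lt hlt)).symm⟩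
    have hXt : X t₀ w = some a := apply_entryTime_mem hr ht₀
    rw [ht₀] at hlt
    have hfin : timeIntegral σ (F 0) ≤ 1 := le_trans (le_add_right le_rfl)
      ((le_add_left le_rfl).trans (hsum 0).le)
    set L : ℝ≥0 → ℝ≥0∞ := {t : ℝ≥0 | (t : ℝ≥0∞) < t₀}.indicator
      fun t => ENNReal.ofReal ((X t w).elim 0 g) * discount g X t w
    -- Discounts decrease in `n`, so `F 0` dominates, with integral at most `1`. Before `t₀` the
    -- density does not depend on `n`; after `t₀` it tends to `0`, being zero at `a` itself.
    have hlimF : Tendsto (fun n => timeIntegral σ (F n)) atTop (𝓝 (timeIntegral σ L)) := by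
      refine tendsto_lintegral_of_dominated_convergence (fun t => F 0 t.toNNReal)
        (fun n => (hFm n).comp measurable_real_toNNReal) (fun n => ae_of_all _ fun t => ?_)
        (ne_top_of_le_ne_top ENNReal.one_ne_top hfin)
        ((ae_restrict_iff' (measurableSet_timeSet σ)).2 (ae_of_all _ fun t ht => ?_))
      · refine mul_le_mul_right (negExp_antitone (timeIntegral_mono fun s _ => ?_)) _
        refine ENNReal.ofReal_le_ofReal ?_
        rcases X s w with _ | l
        · simp
        · rcases eq_or_ne l a with rfl | hl <;> simp [*]
      · set s := t.toNNReal
        rcases lt_or_ge s t₀ with hs | hs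
        · have hs' : (s : ℝ≥0∞) < t₀ := by exact_mod_cast hs
          have hne : X s w ≠ some a := fun h =>
            absurd hs' (not_lt.2 (ht₀ ▸ iInf₂_le s h : (t₀ : ℝ≥0∞) ≤ s))
          have hL : L s = ENNReal.ofReal ((X s w).elim 0 g) * discount g X s w :=
            Set.indicator_of_mem (by exact hs') _
          rw [hL]
          refine tendsto_const_nhds.congr fun n => ?_
          simp only [F, D, if_neg hne]
          rw [discount_update_of_lt_hitTime g _ (by rw [ht₀]; exact hs'.le)]
        · have hL : L s = 0 := Set.indicator_of_notMem (by
            rw [Set.mem_ofPred_eq, not_lt]; exact_mod_cast hs) _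
          rw [hL]
          by_cases hsa : X s w = some a
          · refine tendsto_const_nhds.congr fun n => ?_
            simp [F, hsa]
          · have hts : t₀ < s := lt_of_le_of_ne hs fun h => hsa (h ▸ hXt)
            have h1 := tendsto_discount_update g hr hXt
              (T := (s : ℝ≥0∞)) (by exact_mod_cast hts)
            have h2 := ENNReal.Tendsto.const_mul h1
              (a := (fun o : Option ℕ => if o = some a then 0 else ENNReal.ofReal (o.elim 0 g))
                (X s w)) (Or.inr (by simp [hsa]))
            rw [mul_zero] at h2
            exact h2
    have hL : timeIntegral σ L =
        timeIntegral t₀ fun t => ENNReal.ofReal ((X t w).elim 0 g) * discount g X t w := by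
      rw [timeIntegral_truncate t₀, timeIntegral_truncate σ]
      congr 1
      rw [Set.indicator_indicator]
      congr 1
      ext t
      exact ⟨fun h => h.2, fun h => ⟨lt_trans (by exact h) hlt, h⟩⟩
    have hend := tendsto_discount_update g hr hXt hlt
    have hJ : ∀ n, J n = 1 - (timeIntegral σ (F n) + discount (Function.update g a n) X σ w) :=
      fun n => ENNReal.eq_sub_of_add_eq
        (ne_top_of_le_ne_top ENNReal.one_ne_top ((le_add_left le_rfl).trans (hsum n).le)) (hsum n)
    have hlim := ENNReal.Tendsto.sub (tendsto_const_nhds (x := (1 : ℝ≥0∞)) (f := atTop (α := ℕ)))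
      (hlimF.add hend) (Or.inl ENNReal.one_ne_top)
    -- the limit is identified through the exponential identity up to `t₀`
    have hPI : timeIntegral t₀ (fun t => ENNReal.ofReal ((X t w).elim 0 g) * discount g X t w) +
        discount g X t₀ w = 1 := by
      -- The sign of `g a` is not controlled, so the identity is applied with that value reset to
      -- `0`, which changes nothing before `t₀`.
      have h1 := timeIntegral_mul_discount hX (hgn 0) (w := w) (T := t₀) hlt.le
      rw [discount_update_of_lt_hitTime g _ ht₀.ge] at h1
      rw [← h1]
      congr 1
      refine timeIntegral_congr fun s hs => ?_
      have hne : X s w ≠ some a := fun h =>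
        absurd hs (not_lt.2 (ht₀ ▸ iInf₂_le s h : (t₀ : ℝ≥0∞) ≤ s))
      rw [discount_update_of_lt_hitTime g _ (by rw [ht₀]; exact hs.le)]
      rcases hx : X s w with _ | l
      · rfl
      · have : l ≠ a := fun h => hne (by rw [hx, h])
        simp [this]
    have hval : 1 - (timeIntegral σ L + 0) = discount g X (hitTime X a w) w := by
      rw [add_zero, hL, ht₀]
      refine (ENNReal.eq_sub_of_add_eq ?_ ((add_comm _ _).trans hPI)).symm
      exact ne_top_of_le_ne_top ENNReal.one_ne_top ((le_add_right le_rfl).trans hPI.le)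
    rw [← hval]
    exact hlim.congr fun n => (hJ n).symm
  · rw [Set.indicator_of_notMem (by exact hlt)]
    refine tendsto_const_nhds.congr fun n => ?_
    simp only [J]
    rw [timeIntegral_congr (g := fun _ => 0)]
    · simp [timeIntegral]
    · intro s hs
      refine Set.indicator_of_notMem (fun h => hlt (lt_of_le_of_lt ?_ hs)) _
      exact iInf₂_le s h

/-- With `h = W(·, N) / W(a, N)`, the operator on `[a, N)` annihilates `h` above `a` and sends it to
`-D` at `a`, where `D` is the quantity assumed positive; hence `v = h / D`. -/
lemma lintegral_killing_at (hQ : IsRateMatrix Q) (hX : IsKilledChain Q X P) {g : ℕ → ℝ}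
    (hg : ∀ n, 1 ≤ n → 0 ≤ g n) {a i N : ℕ} (hai : a < i) (hiN : i < N) {r : ℝ} (hr : 0 ≤ r)
    (hpos : 0 < r - ∑ l ∈ Finset.Ico a N, Q a l *
      (W Q (g + killingRate Q) l N / W Q (g + killingRate Q) a N)) :
    ∫⁻ w, timeIntegral (exitTime X (Finset.Ico a N) w) (fun t =>
      {t : ℝ≥0 | X t w = some a}.indicator
        (fun t => discount (Function.update g a r) X (t : ℝ≥0∞) w) t) ∂(P i) =
      ENNReal.ofReal (W Q (g + killingRate Q) i N / W Q (g + killingRate Q) a N /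
        (r - ∑ l ∈ Finset.Ico a N, Q a l *
          (W Q (g + killingRate Q) l N / W Q (g + killingRate Q) a N))) := by
  have haN : a < N := hai.trans hiN
  have hWa : 0 < W Q (g + killingRate Q) a N :=
    W_pos hQ (fun n hn => add_nonneg (hg n hn) (killingRate_nonneg hQ n)) haN
  set h : ℕ → ℝ := fun l => W Q (g + killingRate Q) l N / W Q (g + killingRate Q) a N with hh
  have hha : h a = 1 := div_self hWa.ne'
  set D := r - ∑ l ∈ Finset.Ico a N, Q a l * h l with hD
  set u : ℕ → ℝ := fun k => ∑ j ∈ Finset.Ioo a N, green Q g a N j k with hu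
  have hua : u a = 0 := Finset.sum_eq_zero fun j _ => green_left hQ hg haN j
  have hIco : ∀ f : ℕ → ℝ, ∑ l ∈ Finset.Ico a N, f l = f a + ∑ l ∈ Finset.Ioo a N, f l :=
    fun f => (Finset.add_sum_Ioo_eq_sum_Ico haN).symm
  set E := ∑ l ∈ Finset.Ico a N, Q a l * u l with hE
  have hrow : ∀ k, a < k → k < N →
      ∑ l ∈ Finset.Ico a N, Q k l * h l - g k * h k = 0 := fun k hak hkN =>
    generator_ratio hQ g hak hkN
  refine (lintegral_occupation hQ hX (g := Function.update g a r)
    -- The summed Green function gives `-1` above `a` but `E` at `a`. Adding `(1 + E) / D` times `h`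
    -- leaves the rows above `a` unchanged and lowers row `a` by `1 + E`, to `-1`.
    (u := fun k => u k + (1 + E) / D * h k) (v := fun k => h k / D) (fun l hl => ?_)
    (Finset.mem_Ico.2 ⟨hai.le, hiN⟩) (Finset.mem_Ico.2 ⟨le_rfl, haN⟩) (fun k hk => ?_)
    fun k hk => ?_).1
  · rcases eq_or_ne l a with rfl | hl'
    · simpa using hr
    · have := Finset.mem_Ico.1 hl
      simpa [hl'] using hg l (by omega)
  · have hk' := Finset.mem_Ico.1 hk
    have e : ∑ l ∈ Finset.Ico a N, Q k l * (u l + (1 + E) / D * h l) =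
        ∑ l ∈ Finset.Ico a N, Q k l * u l +
          (1 + E) / D * ∑ l ∈ Finset.Ico a N, Q k l * h l := by
      rw [Finset.mul_sum, ← Finset.sum_add_distrib]
      exact Finset.sum_congr rfl fun l _ => by ring
    rw [e]
    rcases eq_or_ne k a with rfl | hne
    · rw [Function.update_self, hua, hha]
      have h1 : ∑ l ∈ Finset.Ico k N, Q k l * h l = r - D := by rw [hD]; ring
      rw [h1, ← hE]
      apply le_of_eq
      field_simp
      ring
    · have hak : a < k := lt_of_le_of_ne hk'.1 hne.symm
      have h1 := generator_sum_green hQ hg hak hk'.2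
      have h2 := hrow k hak hk'.2
      rw [Function.update_of_ne hne, hIco fun l => Q k l * u l, hua]
      apply le_of_eq
      simp only [hu] at h1 ⊢
      linear_combination h1 + (1 + E) / D * h2
  · have hk' := Finset.mem_Ico.1 hk
    have e : ∑ l ∈ Finset.Ico a N, Q k l * (h l / D) =
        (∑ l ∈ Finset.Ico a N, Q k l * h l) / D := by
      rw [Finset.sum_div]
      exact Finset.sum_congr rfl fun l _ => by ring
    rw [e]
    rcases eq_or_ne k a with rfl | hne
    · rw [Function.update_self, hha, if_pos rfl]
      have h1 : ∑ l ∈ Finset.Ico k N, Q k l * h l = r - D := by rw [hD]; ring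
      rw [h1]
      field_simp
      ring
    · have hak : a < k := lt_of_le_of_ne hk'.1 hne.symm
      have h2 := hrow k hak hk'.2
      rw [Function.update_of_ne hne, if_neg hne]
      linear_combination h2 / D

/-- Take killing rate `n → ∞` at `a`: the discounted killing there is bounded by `1` and converges
pathwise, while its explicit expectation `n x / (n - C)` tends to `x`. -/
lemma lintegral_discount_hitTime_lt_exitTime (hQ : IsRateMatrix Q) (hX : IsKilledChain Q X P)
    {g : ℕ → ℝ} (hg : ∀ n, 1 ≤ n → 0 ≤ g n) {a i N : ℕ} (hai : a < i) (hiN : i < N) :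
    ∫⁻ w, {w | hitTime X a w < exitTime X (Finset.Ico a N) w}.indicator
        (fun w => discount g X (hitTime X a w) w) w ∂(P i) =
      ENNReal.ofReal (W Q (g + killingRate Q) i N / W Q (g + killingRate Q) a N) := by
  have := hX.prob
  have haS : a ∈ Finset.Ico a N := Finset.mem_Ico.2 ⟨le_rfl, hai.trans hiN⟩
  have hgS : ∀ l ∈ Finset.Ico a N, l ≠ a → 0 ≤ g l := fun l hl hne =>
    hg l (by have := Finset.mem_Ico.1 hl; omega)
  set C := ∑ l ∈ Finset.Ico a N, Q a l *
      (W Q (g + killingRate Q) l N / W Q (g + killingRate Q) a N) with hC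
  set x := W Q (g + killingRate Q) i N / W Q (g + killingRate Q) a N
  have l1 := tendsto_lintegral_of_dominated_convergence (μ := P i)
    (F := fun n w => (n : ℝ≥0∞) * timeIntegral (exitTime X (Finset.Ico a N) w)
      (fun t => {t : ℝ≥0 | X t w = some a}.indicator
        (fun t => discount (Function.update g a n) X (t : ℝ≥0∞) w) t)) (fun _ => 1)
    (fun n => (measurable_timeIntegral (measurable_indicator_discount hX _ _)
      (measurable_exitTime hX _)).const_mul _)
    (fun n => ae_of_all _ fun w => (tendsto_killing_at hX haS hgS w).2 n) (by simp)
    (ae_of_all _ fun w => (tendsto_killing_at hX haS hgS w).1)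
  refine tendsto_nhds_unique l1 ?_
  have l2 : Tendsto (fun n : ℕ => ENNReal.ofReal (n * (x / (n - C)))) atTop
      (𝓝 (ENNReal.ofReal x)) := by
    refine (ENNReal.continuous_ofReal.tendsto x).comp ?_
    have h1 : Tendsto (fun n : ℕ => (1 : ℝ) - C / n) atTop (𝓝 (1 - 0)) :=
      tendsto_const_nhds.sub (tendsto_const_div_atTop_nhds_zero_nat C)
    have h2 : Tendsto (fun n : ℕ => x / (1 - C / n)) atTop (𝓝 (x / (1 - 0))) :=
      tendsto_const_nhds.div h1 (by norm_num)
    rw [sub_zero, div_one] at h2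
    refine h2.congr' ?_
    filter_upwards [eventually_gt_atTop 0] with n hn
    have hn' : (n : ℝ) ≠ 0 := by positivity
    have e : 1 - C / n = (n - C) / n := by rw [sub_div, div_self hn']
    rw [e, div_div_eq_mul_div]
    ring
  refine l2.congr' ?_
  filter_upwards [eventually_gt_atTop ⌈C⌉₊] with n hn
  have hn' : C < n := (Nat.le_ceil C).trans_lt (by exact_mod_cast hn)
  rw [lintegral_const_mul _ (measurable_timeIntegral (measurable_indicator_discount hX _ _)
      (measurable_exitTime hX _)),
    lintegral_killing_at hQ hX hg hai hiN n.cast_nonneg (by rw [← hC]; linarith),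
    ENNReal.ofReal_mul n.cast_nonneg, ENNReal.ofReal_natCast]

end

/-! ### The two-sided exit problem. -/

section

variable {Ω : Type*} [MeasurableSpace Ω] {Q : ℕ → ℕ → ℝ} {X : ℝ≥0 → Ω → Option ℕ}
  {P : ℕ → Measure Ω}

/-! ### The exit problem -/

/-- The forward direction is the probabilistic one: by skip-freeness the path stays in `(a, N)`
until it sits at `a`. The converse holds on every path, as `[a, N) ⊆ [0, N)`. -/
lemma ae_hitTime_lt_iff (hQ : IsRateMatrix Q) (hX : IsKilledChain Q X P) {a i N : ℕ}
    (hai : a < i) (hiN : i < N) :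
    ∀ᵐ w ∂(P i), hitTime X a w < min (passTime X N w) (killTime X w) ↔
      hitTime X a w < exitTime X (Finset.Ico a N) w := by
  filter_upwards [ae_exitTime_Ioo_eq hQ hX hai hiN] with w hw
  have hr := hX.rightConst w
  rw [← min_hitTime_eq_exitTime] at hw
  constructor
  · intro h
    obtain ⟨t, ht⟩ : ∃ t : ℝ≥0, hitTime X a w = t :=
      ⟨_, (ENNReal.coe_toNNReal (ne_top_of_lt h)).symm⟩
    rw [min_eq_left h.le] at hw
    rw [ht, lt_exitTime_iff hr]
    intro s hs
    rcases hs.eq_or_lt with rfl | hs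
    · exact ⟨a, by simpa using hai.trans hiN, (apply_entryTime_mem hr ht).symm⟩
    · have hs' : (s : ℝ≥0∞) < exitTime X (Finset.Ioo a N) w := by
        rw [hw, ht]; exact_mod_cast hs
      obtain ⟨l, hl, hxl⟩ := exists_of_lt_exitTime hr hs'
      have := Finset.mem_Ioo.1 hl
      exact ⟨l, by simp; omega, hxl.symm⟩
  · intro h
    obtain ⟨t, ht⟩ : ∃ t : ℝ≥0, hitTime X a w = t :=
      ⟨_, (ENNReal.coe_toNNReal (ne_top_of_lt h)).symm⟩
    rw [min_passTime_eq_exitTime, ht, lt_exitTime_iff hr]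
    rw [ht, lt_exitTime_iff hr] at h
    refine fun s hs => Set.image_mono (fun l hl => ?_) (h s hs)
    simp at hl ⊢; omega

lemma measurableSet_hitTime_lt (hX : IsKilledChain Q X P) (a N : ℕ) :
    MeasurableSet {w | hitTime X a w < min (passTime X N w) (killTime X w)} :=
  measurableSet_lt (measurable_entryTime hX _)
    ((measurable_entryTime hX _).min (measurable_entryTime hX _))

lemma measurableSet_lt_hitTime (hX : IsKilledChain Q X P) (a N : ℕ) :
    MeasurableSet {w | min (passTime X N w) (killTime X w) < hitTime X a w} :=
  measurableSet_lt ((measurable_entryTime hX _).min (measurable_entryTime hX _))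
    (measurable_entryTime hX _)

/-- The chain reaches `a` before passing `N` or being killed. -/
lemma setLIntegral_discount_hitTime (hQ : IsRateMatrix Q) (hX : IsKilledChain Q X P)
    {g : ℕ → ℝ} (hg : ∀ n, 1 ≤ n → 0 ≤ g n) {a i N : ℕ} (hai : a < i) (hiN : i < N) :
    ∫⁻ w in {w | hitTime X a w < min (passTime X N w) (killTime X w)},
        discount g X (hitTime X a w) w ∂(P i) =
      ENNReal.ofReal (W Q (g + killingRate Q) i N / W Q (g + killingRate Q) a N) := by
  rw [← lintegral_indicator (measurableSet_hitTime_lt hX a N),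
    ← lintegral_discount_hitTime_lt_exitTime hQ hX hg hai hiN]
  refine lintegral_congr_ae ?_
  filter_upwards [ae_hitTime_lt_iff hQ hX hai hiN] with w hw
  by_cases h : hitTime X a w < min (passTime X N w) (killTime X w)
  · rw [Set.indicator_of_mem (by exact h), Set.indicator_of_mem (by exact hw.1 h)]
  · rw [Set.indicator_of_notMem (by exact h),
      Set.indicator_of_notMem (by exact fun H => h (hw.2 H))]

/-- Undiscounted occupation times of the finitely many states have finite mean and add up to the
exit time. This excludes paths that never exit, which belong to neither exit event yet carry
discount `1` when `g = 0`. -/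
lemma ae_exitTime_Ioo_lt_top (hQ : IsRateMatrix Q) (hX : IsKilledChain Q X P) {a i N : ℕ}
    (hai : a < i) (hiN : i < N) :
    ∀ᵐ w ∂(P i), exitTime X (Finset.Ioo a N) w < ⊤ := by
  have hfin : ∀ j ∈ Finset.Ioo a N, ∀ᵐ w ∂(P i), timeIntegral (exitTime X (Finset.Ioo a N) w)
      (fun t => {t : ℝ≥0 | X t w = some j}.indicator
        (fun t => discount 0 X (t : ℝ≥0∞) w) t) < ⊤ := by
    intro j hj
    obtain ⟨haj, hjN⟩ := Finset.mem_Ioo.1 hj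
    refine ae_lt_top (measurable_timeIntegral (measurable_indicator_discount hX _ _)
      (measurable_exitTime hX _)) ?_
    rw [(lintegral_occupation_Ioo hQ hX (g := 0) (fun _ _ => le_rfl) hai hiN haj hjN).1]
    exact ENNReal.ofReal_ne_top
  filter_upwards [(Finset.Ioo a N).eventually_all.2 hfin] with w hw
  have hdisc : ∀ t : ℝ≥0∞, discount 0 X t w = 1 := fun t => by
    change negExp _ = 1
    rw [timeIntegral_congr (g := fun _ => 0)]
    · simp [timeIntegral, negExp_zero]
    · intro s _
      rcases X s w with _ | l <;> simp
  simp_rw [hdisc] at hw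
  rw [lt_top_iff_ne_top]
  intro htop
  have hm : ∀ j, Measurable fun t : ℝ => {t : ℝ≥0 | X t w = some j}.indicator
      (fun _ => (1 : ℝ≥0∞)) t.toNNReal := fun j => by
    have := (measurable_path hX (fun o => if o = some j then 1 else 0) w).comp
      measurable_real_toNNReal
    simpa [Set.indicator_apply, Function.comp_def] using this
  have hsum : timeIntegral (exitTime X (Finset.Ioo a N) w) (fun _ => 1) =
      ∑ j ∈ Finset.Ioo a N, timeIntegral (exitTime X (Finset.Ioo a N) w)
        (fun t => {t : ℝ≥0 | X t w = some j}.indicator (fun _ => (1 : ℝ≥0∞)) t) := by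
    refine Eq.trans ?_ (lintegral_finsetSum _ fun j _ => hm j)
    refine timeIntegral_congr (g := fun t => ∑ j ∈ Finset.Ioo a N,
      {t : ℝ≥0 | X t w = some j}.indicator (fun _ => (1 : ℝ≥0∞)) t) fun t ht => ?_
    obtain ⟨l, hl, hxl⟩ := exists_of_lt_exitTime (hX.rightConst w) ht
    rw [Finset.sum_eq_single l]
    · rw [Set.indicator_of_mem (by exact hxl)]
    · intro b _ hb
      refine Set.indicator_of_notMem (fun h => ?_) _
      exact hb (Option.some_injective _ (Eq.trans (Eq.symm h) hxl))
    · exact fun h => absurd hl h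
  have hlt : timeIntegral (exitTime X (Finset.Ioo a N) w) (fun _ => 1) < ⊤ := by
    rw [hsum]; exact ENNReal.sum_lt_top.2 hw
  rw [htop, timeIntegral_top] at hlt
  simp at hlt

/-- The chain passes `N` or is killed before reaching `a`. -/
lemma setLIntegral_discount_passTime (hQ : IsRateMatrix Q) (hX : IsKilledChain Q X P)
    {g : ℕ → ℝ} (hg : ∀ n, 1 ≤ n → 0 ≤ g n) {a i N : ℕ} (hai : a < i) (hiN : i < N) :
    ENNReal.ofReal (∑ j ∈ Finset.Ioo a N, g j * green Q g a N j i) +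
      (ENNReal.ofReal (W Q (g + killingRate Q) i N / W Q (g + killingRate Q) a N) +
      ∫⁻ w in {w | min (passTime X N w) (killTime X w) < hitTime X a w},
        discount g X (min (passTime X N w) (killTime X w)) w ∂(P i)) = 1 := by
  have := hX.prob
  set S := Finset.Ioo a N
  have hgS : ∀ l ∈ S, 0 ≤ g l := fun l hl => hg l (by have := Finset.mem_Ioo.1 hl; omega)
  have hocc : ∀ j ∈ S, _ := fun j hj => lintegral_occupation_Ioo hQ hX hg hai hiN
    (Finset.mem_Ioo.1 hj).1 (Finset.mem_Ioo.1 hj).2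
  have hmeas : ∀ j, Measurable fun w => timeIntegral (exitTime X S w)
      (fun t => {t : ℝ≥0 | X t w = some j}.indicator
        (fun t => discount g X (t : ℝ≥0∞) w) t) := fun j =>
    measurable_timeIntegral (measurable_indicator_discount hX _ _) (measurable_exitTime hX _)
  have hsum : ENNReal.ofReal (∑ j ∈ S, g j * green Q g a N j i) =
      ∫⁻ w, ∑ j ∈ S, ENNReal.ofReal (g j) * timeIntegral (exitTime X S w)
        (fun t => {t : ℝ≥0 | X t w = some j}.indicator
          (fun t => discount g X (t : ℝ≥0∞) w) t) ∂(P i) := by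
    rw [lintegral_finsetSum _ fun j _ => (hmeas j).const_mul _,
      ENNReal.ofReal_sum_of_nonneg fun j hj => mul_nonneg (hgS j hj) (hocc j hj).2]
    refine Finset.sum_congr rfl fun j hj => ?_
    rw [lintegral_const_mul _ (hmeas j), (hocc j hj).1, ENNReal.ofReal_mul (hgS j hj)]
  have hexit : ∫⁻ w, discount g X (exitTime X S w) w ∂(P i) =
      ENNReal.ofReal (W Q (g + killingRate Q) i N / W Q (g + killingRate Q) a N) +
      ∫⁻ w in {w | min (passTime X N w) (killTime X w) < hitTime X a w},
        discount g X (min (passTime X N w) (killTime X w)) w ∂(P i) := by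
    have hm : Measurable fun w => discount g X (hitTime X a w) w :=
      measurable_discount hX g (measurable_entryTime hX _) measurable_id
    rw [← setLIntegral_discount_hitTime hQ hX hg hai hiN,
      ← lintegral_indicator (measurableSet_hitTime_lt hX a N),
      ← lintegral_indicator (measurableSet_lt_hitTime hX a N),
      ← lintegral_add_left (hm.indicator (measurableSet_hitTime_lt hX a N))]
    refine lintegral_congr_ae ?_
    filter_upwards [ae_exitTime_Ioo_eq hQ hX hai hiN, ae_exitTime_Ioo_lt_top hQ hX hai hiN]
      with w hw hlt
    rw [← min_hitTime_eq_exitTime] at hw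
    rcases lt_trichotomy (hitTime X a w) (min (passTime X N w) (killTime X w)) with h | h | h
    · rw [Set.indicator_of_mem (by exact h), Set.indicator_of_notMem (by exact not_lt.2 h.le),
        add_zero, hw, min_eq_left h.le]
    -- A tie at a finite time would place the path at `a < N` and outside `[0, N)` simultaneously.
    · exfalso
      rw [hw, ← h, min_self] at hlt
      obtain ⟨t, ht⟩ : ∃ t : ℝ≥0, hitTime X a w = t :=
        ⟨_, (ENNReal.coe_toNNReal hlt.ne).symm⟩
      have h1 : X t w = some a := apply_entryTime_mem (hX.rightConst w) ht
      rw [min_passTime_eq_exitTime, ht] at h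
      have h2 := apply_entryTime_mem (hX.rightConst w) h.symm
      exact h2 ⟨a, by simpa using hai.trans hiN, h1.symm⟩
    · rw [Set.indicator_of_notMem (by exact not_lt.2 h.le), Set.indicator_of_mem (by exact h),
        zero_add, hw, min_eq_right h.le]
  rw [hsum, ← hexit, ← lintegral_add_left
    (Finset.measurable_sum _ fun j _ => (hmeas j).const_mul _)]
  have hone : ∀ w, ∑ j ∈ S, ENNReal.ofReal (g j) * timeIntegral (exitTime X S w)
      (fun t => {t : ℝ≥0 | X t w = some j}.indicator
        (fun t => discount g X (t : ℝ≥0∞) w) t) + discount g X (exitTime X S w) w = 1 := fun w => by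
    rw [← timeIntegral_mul_discount_eq_sum hX S g w]
    exact timeIntegral_mul_discount hX hgS le_rfl
  simp_rw [hone]
  simp

lemma coe_ofReal_ereal {x : ℝ} (hx : 0 ≤ x) : ((ENNReal.ofReal x : ℝ≥0∞) : EReal) = (x : EReal) := by
  rw [EReal.coe_ennreal_ofReal, max_eq_left hx]

end

end SingleDeath

end

/-! ### The three identities. -/

theorem mainTheorem5 {Ω : Type*} [MeasurableSpace Ω]
    (Q : ℕ → ℕ → ℝ) (hQ : IsRateMatrix Q)
    (c : ℕ → ℝ) (hc : c = killingRate Q) (hc_pos : ∃ i₀, 1 ≤ i₀ ∧ 0 < c i₀)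
    (X : ℝ≥0 → Ω → Option ℕ) (P : ℕ → Measure Ω) (hX : IsKilledChain Q X P)
    (ω : ℕ → ℝ) (hω : ∀ i, 1 ≤ i → 0 ≤ ω i) :
    (∀ a i N : ℕ, a < i → i < N →
      ((∫⁻ w in {w | hitTime X a w < min (passTime X N w) (killTime X w)},
          discount ω X (hitTime X a w) w ∂(P i) : ℝ≥0∞) : EReal) =
        ((W Q (ω + c) i N / W Q (ω + c) a N : ℝ) : EReal)) ∧
    (∀ a i j N : ℕ, a < i → a < j → i < N → j < N →
      ((∫⁻ w, timeIntegral (min (hitTime X a w) (min (passTime X N w) (killTime X w)))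
          (fun t => {t : ℝ≥0 | X t w = some j}.indicator
            (fun t => discount ω X (t : ℝ≥0∞) w) t) ∂(P i) : ℝ≥0∞) : EReal) =
        ((W Q (ω + c) a j * W Q (ω + c) i N / W Q (ω + c) a N - W Q (ω + c) i j : ℝ) : EReal)) ∧
    (∀ a i N : ℕ, a < i → i < N →
      ((∫⁻ w in {w | min (passTime X N w) (killTime X w) < hitTime X a w},
          discount ω X (min (passTime X N w) (killTime X w)) w ∂(P i) : ℝ≥0∞) : EReal) =
        ((1 + ∑ j ∈ Finset.Ioo i N, ω j * W Q (ω + c) i j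
          - W Q (ω + c) i N / W Q (ω + c) a N *
            (1 + ∑ j ∈ Finset.Ioo a N, ω j * W Q (ω + c) a j) : ℝ) : EReal)) := by
  subst hc
  have hf : ∀ n, 1 ≤ n → 0 ≤ (ω + killingRate Q) n := fun n hn =>
    add_nonneg (hω n hn) (killingRate_nonneg hQ n)
  have hratio : ∀ a i N : ℕ, a < i → i < N →
      0 ≤ W Q (ω + killingRate Q) i N / W Q (ω + killingRate Q) a N := fun a i N hai hiN =>
    div_nonneg (W_pos hQ hf hiN).le (W_pos hQ hf (hai.trans hiN)).le
  refine ⟨fun a i N hai hiN => ?_, fun a i j N hai haj hiN hjN => ?_, fun a i N hai hiN => ?_⟩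
  · rw [setLIntegral_discount_hitTime hQ hX hω hai hiN, coe_ofReal_ereal (hratio a i N hai hiN)]
  · have h := lintegral_occupation_Ioo hQ hX hω hai hiN haj hjN
    -- Non-negativity of the Green function is read off from its occupation-time meaning, not from
    -- its formula.
    refine Eq.trans (congrArg _ ?_) (coe_ofReal_ereal h.2)
    refine Eq.trans (lintegral_congr_ae ?_) h.1
    filter_upwards [ae_exitTime_Ioo_eq hQ hX hai hiN] with w hw
    rw [min_hitTime_eq_exitTime, hw]
  · have h := setLIntegral_discount_passTime hQ hX hω hai hiN
    set Z := ∫⁻ w in {w | min (passTime X N w) (killTime X w) < hitTime X a w},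
      discount ω X (min (passTime X N w) (killTime X w)) w ∂(P i)
    set f := ω + killingRate Q
    have hgreen : 0 ≤ ∑ j ∈ Finset.Ioo a N, ω j * green Q ω a N j i :=
      Finset.sum_nonneg fun j hj => by
        obtain ⟨haj, hjN⟩ := Finset.mem_Ioo.1 hj
        exact mul_nonneg (hω j (by omega)) (lintegral_occupation_Ioo hQ hX hω hai hiN haj hjN).2
    -- Finiteness follows from the total being `1`, after which the additive identity can be solved
    -- for `Z` in the reals.
    have hZ : Z ≠ ⊤ := fun hZ => by simp [hZ] at h
    have hreal := congrArg ENNReal.toReal h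
    rw [ENNReal.toReal_add ENNReal.ofReal_ne_top (by simp [hZ]),
      ENNReal.toReal_add ENNReal.ofReal_ne_top hZ, ENNReal.toReal_ofReal hgreen,
      ENNReal.toReal_ofReal (hratio a i N hai hiN), ENNReal.toReal_one] at hreal
    -- The terms with `a < j ≤ i` vanish, since `W(i, j) = 0` there.
    have hsub : ∑ j ∈ Finset.Ioo i N, ω j * W Q f i j = ∑ j ∈ Finset.Ioo a N, ω j * W Q f i j :=
      Finset.sum_subset (Finset.Ioo_subset_Ioo_left hai.le) fun j hj hj' => by
        rw [W_eq_zero Q f (by simp only [Finset.mem_Ioo] at hj hj'; omega), mul_zero]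
    have hsum : ∑ j ∈ Finset.Ioo a N, ω j * green Q ω a N j i =
        W Q f i N / W Q f a N * ∑ j ∈ Finset.Ioo a N, ω j * W Q f a j -
          ∑ j ∈ Finset.Ioo a N, ω j * W Q f i j := by
      rw [Finset.mul_sum, ← Finset.sum_sub_distrib]
      exact Finset.sum_congr rfl fun j _ => by rw [green]; ring
    rw [← ENNReal.ofReal_toReal hZ, coe_ofReal_ereal ENNReal.toReal_nonneg, EReal.coe_eq_coe_iff,
      hsub]
    linear_combination hreal - hsum
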